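/- \textbf{Setting.} Let $p\in(0,1)$, $q\in[0,1]$, $\lambda\ge 0$. Let $d:[0,\infty)\to\mathbb{R}$ be convex and nondecreasing with $d(0)>0$ and, for every $\delta>0$, $d(r+\delta)-d(r)\to\infty$ as $r\to\infty$. Write $d(x,y):=d(\sqrt{x^2+y^2})$ and assume that $d(x,y)$ is twice continuously differentiable on $\{x>0,\,y>0\}$ with $d_{xx}>0$, $d_{yy}>0$ and $d_{xy}\ge 0$ there. For $(m,n)\in\mathbb{Z}_+^2$ let $\Delta_q(m,n)=q\,(d(m+1,n)-d(m,n))+(1-q)\,(d(m,n+1)-d(m,n))$. \textbf{The decision problem.} Consider the total-cost Markov decision process with states $(m,n,\mathsf{c})$ (path continues), $(m,n,\mathsf{e})$ (path has ended), where $(m,n)\in\mathbb{Z}_+^2$ is the position relative to the previous relay, and a cost-free absorbing state. In $(m,n,\mathsf{c})$ one may place a relay, which costs $\lambda+d(m,n)$ and resets the position to $(0,0)$, or not place, which costs $0$; then the path makes one step, East with probability $q$ and North with probability $1-q$, and independently ends after this step with probability $p$. In $(m,n,\mathsf{e})$ the cost $d(m,n)$ is incurred and the process enters the absorbing state. Let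 $J_\lambda(m,n)$ be the infimum, over all randomized history-dependent policies, of the expected total cost from $(m,n,\mathsf{c})$. Let $$c_p(m,n)=\lambda+d(m,n)+(1-p)(1-q)J_\lambda(0,1)+(1-p)q\,J_\lambda(1,0)+p\,d(1),$$ $$c_{np}(m,n)=(1-p)q\,J_\lambda(m+1,n)+(1-p)(1-q)J_\lambda(m,n+1)+pq\,d(m+1,n)+p(1-q)\,d(m,n+1),$$ and let $\mathcal{P}_\lambda=\{(m,n)\in\mathbb{Z}_+^2: c_p(m,n)\le c_{np}(m,n)\}$ be the optimal placement set and $g^*:=J_\lambda(0,0)$. \textbf{The function $g$.} For $h\ge 0$ let $\mathcal{P}(h)=\{(m,n)\in\mathbb{Z}_+^2: p(\lambda+h)\le\Delta_q(m,n)\}$ and $C=(\mathbb{Z}_+^2\setminus\mathcal{P}(h))\cup\{(0,0)\}$, and let $\mathcal{B}$ be the set of points of $\mathbb{Z}_+^2\setminus C$ whose western or southern neighbour lies in $C$. Consider the path started at $(0,0)$, where a relay has just been placed, up to its first visit to $\mathcal{B}$ or its end, whichever comes first. Let $\mathbb{P}((m,n),\mathsf{e})$ be the probability that it ends at $(m,n)\in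 C\cup\mathcal{B}$, and $\mathbb{P}((m,n),\mathsf{c})$ the probability that it reaches $(m,n)\in\mathcal{B}$ and continues. Explicitly, $$\mathbb{P}((m,n),\mathsf{c})=N(m,n)(1-p)^{m+n}q^m(1-q)^n,$$ $$\mathbb{P}((m,n),\mathsf{e})=N(m,n)\,p(1-p)^{m+n-1}q^m(1-q)^n\ \text{ for } (m,n)\ne(0,0),\qquad \mathbb{P}((0,0),\mathsf{e})=0,$$ where $N(m,n)=\binom{m+n-1}{m}$ if $(m,n)\in\mathcal{B}$ and $(m-1,n)\in\mathcal{B}$; $N(m,n)=\binom{m+n-1}{m-1}$ if $(m,n)\in\mathcal{B}$ and $(m,n-1)\in\mathcal{B}$; and $N(m,n)=\binom{m+n}{m}$ otherwise. The renewal cost of using $\mathcal{P}(h)$ is $$g(h)=\frac{\sum_{(m,n)\in C\cup\mathcal{B}}\mathbb{P}((m,n),\mathsf{e})\,d(m,n)+\sum_{(m,n)\in\mathcal{B}}\mathbb{P}((m,n),\mathsf{c})(\lambda+d(m,n))}{1-\sum_{(m,n)\in\mathcal{B}}\mathbb{P}((m,n),\mathsf{c})}.$$ \textbf{Algorithm.}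 Start with $h^{(0)}=0$. In pass $k$ compute $g(h^{(k)})$; if $g(h^{(k)})=h^{(k)}$, stop and return the pair $(g(h^{(k)}),\mathcal{P}(h^{(k)}))$; otherwise set $h^{(k+1)}=g(h^{(k)})$ and go on. \textbf{Theorem.} $J_\lambda(0,0)$ is finite, $g^*=J_\lambda(0,0)=\min_{h\ge0}g(h)$ (the minimum is attained), and the algorithm terminates after finitely many passes and returns $(g^*,\mathcal{P}_\lambda)$; equivalently, it returns $g^*$ and the complement of $\mathcal{P}_\lambda$. -/

import Mathlib

open scoped ENNReal

noncomputable section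

namespace RelayPlacement

/-! ### The one-hop cost -/

/-- The one-hop cost between `(0,0)` and `(x,y)`, where `d` is the one-hop cost as a function of
the Euclidean distance. -/
def hop (d : ℝ → ℝ) (x y : ℝ) : ℝ := d (Real.sqrt (x ^ 2 + y ^ 2))

/-- The standing conditions on the one-hop cost as a function of the distance `r ≥ 0`.
The differences `d (r + δ) - d r` are automatically monotone in `r`, by convexity, and `d` is
automatically positive. The partial derivatives are considered at `x, y > 0`. -/
structure IsHopCost (d : ℝ → ℝ) : Prop where
  pos_zero : 0 < d 0
  convex : ConvexOn ℝ (Set.Ici 0) d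
  increasing : MonotoneOn d (Set.Ici 0)
  diff_tendsto : ∀ δ : ℝ, 0 < δ →
    Filter.Tendsto (fun r : ℝ => d (r + δ) - d r) Filter.atTop Filter.atTop
  smooth : ContDiffOn ℝ 2 (fun z : ℝ × ℝ => hop d z.1 z.2) (Set.Ioi 0 ×ˢ Set.Ioi 0)
  dxx_pos : ∀ x y : ℝ, 0 < x → 0 < y → 0 < deriv (fun s => deriv (fun t => hop d t y) s) x
  dyy_pos : ∀ x y : ℝ, 0 < x → 0 < y → 0 < deriv (fun s => deriv (fun t => hop d x t) s) y
  dxy_nonneg : ∀ x y : ℝ, 0 < x → 0 < y → 0 ≤ deriv (fun s => deriv (fun t => hop d s t) y) x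

/-- `Δ₁(m,n) = d(m+1,n) - d(m,n)`. -/
def delta1 (d : ℝ → ℝ) (m n : ℕ) : ℝ := hop d (m + 1) n - hop d m n

/-- `Δ₂(m,n) = d(m,n+1) - d(m,n)`. -/
def delta2 (d : ℝ → ℝ) (m n : ℕ) : ℝ := hop d m (n + 1) - hop d m n

/-- `Δ_q(m,n) = q Δ₁(m,n) + (1-q) Δ₂(m,n)`. -/
def deltaq (d : ℝ → ℝ) (q : ℝ) (m n : ℕ) : ℝ := q * delta1 d m n + (1 - q) * delta2 d m n

/-! ### The Markov decision process and the optimal placement set -/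

/-- States: `run m n` and `ended m n` are the states `(m,n,c)` and `(m,n,e)`, where `(m,n)` is the
position relative to the previous relay; `done` is the cost-free terminal state. -/
inductive State : Type
  | run (m n : ℕ)
  | ended (m n : ℕ)
  | done

/-- The coin that shows `true` with probability `a`. -/
def coin (a : unitInterval) : PMF Bool :=
  PMF.ofFintype (fun b => if b then ENNReal.ofReal a else ENNReal.ofReal (1 - (a : ℝ))) (by
    have h0 : (0 : ℝ) ≤ a := a.2.1
    have h1 : (0 : ℝ) ≤ 1 - a := sub_nonneg.2 a.2.2
    simp [← ENNReal.ofReal_add h0 h1])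

/-- One step of the path from relative position `(m,n)`: East with probability `q`, North
otherwise, and, independently, the path ends after this step with probability `p`. -/
def move (p q : unitInterval) (m n : ℕ) : PMF State :=
  (coin q).bind fun east => (coin p).map fun fin =>
    match east, fin with
    | true, false => State.run (m + 1) n
    | true, true => State.ended (m + 1) n
    | false, false => State.run m (n + 1)
    | false, true => State.ended m (n + 1)

/-- The transition law. The action `true` is "place", which resets the relative position. Once
the path has ended the action is irrelevant (the source is placed there in any case). -/
def trans (p q : unitInterval) : State → Bool → PMF State
  | State.run _ _, true => move p q 0 0
  | State.run m n, false => move p q m n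
  | State.ended _ _, _ => PMF.pure State.done
  | State.done, _ => PMF.pure State.done

/-- The one-step cost. -/
def stepCost (d : ℝ → ℝ) (lam : ℝ) : State → Bool → ℝ≥0∞
  | State.run m n, true => ENNReal.ofReal (lam + hop d m n)
  | State.run _ _, false => 0
  | State.ended m n, _ => ENNReal.ofReal (hop d m n)
  | State.done, _ => 0

/-- The past state-action pairs, most recent first. -/
abbrev Hist : Type := List (State × Bool)

/-- A randomized, history-dependent policy. -/
abbrev Policy : Type := Hist → State → PMF Bool

/-- The joint law of the history and the current state after `k` steps under the policy `π`,
started in the state `s`. -/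
def law (p q : unitInterval) (π : Policy) (s : State) : ℕ → PMF (Hist × State)
  | 0 => PMF.pure ([], s)
  | k + 1 => (law p q π s k).bind fun x => (π x.1 x.2).bind fun u =>
      (trans p q x.2 u).map fun s' => ((x.2, u) :: x.1, s')

/-- The expected total cost of the policy `π`, started in the state `s`. -/
def policyCost (d : ℝ → ℝ) (p q : unitInterval) (lam : ℝ) (π : Policy) (s : State) : ℝ≥0∞ :=
  ∑' k : ℕ, ∑' x : Hist × State, law p q π s k x * ∑ u : Bool, π x.1 x.2 u * stepCost d lam x.2 u

/-- The optimal cost-to-go `J_λ(m,n)` from the state `(m,n,c)`. -/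
def optCost (d : ℝ → ℝ) (p q : unitInterval) (lam : ℝ) (m n : ℕ) : ℝ≥0∞ :=
  ⨅ π : Policy, policyCost d p q lam π (State.run m n)

/-- The cost `c_p(m,n)` of placing a relay now and continuing optimally. -/
def costPlace (d : ℝ → ℝ) (p q : unitInterval) (lam : ℝ) (m n : ℕ) : ℝ≥0∞ :=
  ENNReal.ofReal (lam + hop d m n)
    + ENNReal.ofReal ((1 - (p : ℝ)) * (1 - (q : ℝ))) * optCost d p q lam 0 1
    + ENNReal.ofReal ((1 - (p : ℝ)) * (q : ℝ)) * optCost d p q lam 1 0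
    + ENNReal.ofReal (p * d 1)

/-- The cost `c_np(m,n)` of not placing a relay now and continuing optimally. -/
def costNotPlace (d : ℝ → ℝ) (p q : unitInterval) (lam : ℝ) (m n : ℕ) : ℝ≥0∞ :=
  ENNReal.ofReal ((1 - (p : ℝ)) * (q : ℝ)) * optCost d p q lam (m + 1) n
    + ENNReal.ofReal ((1 - (p : ℝ)) * (1 - (q : ℝ))) * optCost d p q lam m (n + 1)
    + ENNReal.ofReal (p * q * hop d (m + 1) n)
    + ENNReal.ofReal (p * (1 - q) * hop d m (n + 1))

/-- The optimal placement set `P_λ`. -/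
def optPlacementSet (d : ℝ → ℝ) (p q : unitInterval) (lam : ℝ) : Set (ℕ × ℕ) :=
  {x | costPlace d p q lam x.1 x.2 ≤ costNotPlace d p q lam x.1 x.2}

/-- `g* = J_λ(0,0)` as a real number (the theorem also asserts that `J_λ(0,0)` is finite). -/
def gStar (d : ℝ → ℝ) (p q : unitInterval) (lam : ℝ) : ℝ := (optCost d p q lam 0 0).toReal

/-! ### The one-step-look-ahead placement sets and their renewal cost -/

/-- `P(h) = {(m,n) : p (λ + h) ≤ Δ_q(m,n)}`. -/
def placementSet (d : ℝ → ℝ) (p q lam h : ℝ) : Set (ℕ × ℕ) :=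
  {x | p * (lam + h) ≤ deltaq d q x.1 x.2}

/-- The points at which a person who has just placed a relay at `(0,0)`, and places the next one
on entering `P(h)` after at least one step, walks on without placing: the complement of `P(h)`,
together with the starting point `(0,0)`. -/
def contSet (d : ℝ → ℝ) (p q lam h : ℝ) : Set (ℕ × ℕ) :=
  (placementSet d p q lam h)ᶜ ∪ {(0, 0)}

/-- The western neighbour of `x` exists and lies in `A`. -/
def WestIn (A : Set (ℕ × ℕ)) (x : ℕ × ℕ) : Prop := 0 < x.1 ∧ (x.1 - 1, x.2) ∈ A

/-- The southern neighbour of `x` exists and lies in `A`. -/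
def SouthIn (A : Set (ℕ × ℕ)) (x : ℕ × ℕ) : Prop := 0 < x.2 ∧ (x.1, x.2 - 1) ∈ A

/-- The boundary of the placement region whose continuation region is `C`. -/
def boundary (C : Set (ℕ × ℕ)) : Set (ℕ × ℕ) := {x | x ∉ C ∧ (WestIn C x ∨ SouthIn C x)}

open Classical in
/-- The number of lattice paths from `(0,0)` to `x = (m,n)` that stay in `C` before they reach
`x`, for `x` in `C` or on its boundary: a boundary point whose western (southern) neighbour is on
the boundary can be reached only from the South (West). In the second case `m > 0`, for the
regions `C` in use. -/
def pathCount (C : Set (ℕ × ℕ)) (x : ℕ × ℕ) : ℕ :=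
  if x ∈ boundary C ∧ WestIn (boundary C) x then (x.1 + x.2 - 1).choose x.1
  else if x ∈ boundary C ∧ SouthIn (boundary C) x then (x.1 + x.2 - 1).choose (x.1 - 1)
  else (x.1 + x.2).choose x.1

/-- The probability `ℙ((m,n),e)` that the path ends at `x = (m,n)`, which is not possible at the
origin. -/
def endProb (p q : ℝ) (C : Set (ℕ × ℕ)) (x : ℕ × ℕ) : ℝ :=
  if x = (0, 0) then 0
  else pathCount C x * p * (1 - p) ^ (x.1 + x.2 - 1) * q ^ x.1 * (1 - q) ^ x.2

/-- The probability `ℙ((m,n),c)` that the path reaches `x = (m,n)` and continues. -/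
def contProb (p q : ℝ) (C : Set (ℕ × ℕ)) (x : ℕ × ℕ) : ℝ :=
  pathCount C x * (1 - p) ^ (x.1 + x.2) * q ^ x.1 * (1 - q) ^ x.2

/-- The renewal cost of using a placement rule with continuation region `C`. -/
def renewalCost (d : ℝ → ℝ) (p q lam : ℝ) (C : Set (ℕ × ℕ)) : ℝ :=
  (1 / (1 - ∑' x : boundary C, contProb p q C x)) *
    ((∑' x : (C ∪ boundary C : Set (ℕ × ℕ)), endProb p q C x * hop d x.1.1 x.1.2)
      + ∑' x : boundary C, contProb p q C x * (lam + hop d x.1.1 x.1.2))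

/-- `g(h)`: the renewal cost of using the placement set `P(h)`. -/
def g (d : ℝ → ℝ) (p q lam h : ℝ) : ℝ := renewalCost d p q lam (contSet d p q lam h)

/-! ### The algorithm -/

open Classical in
/-- The loop of the OSLA based fixed point iteration, entered with the current value `h` and cut
off after `N` passes: `some` is the returned pair, `none` means that the loop has not terminated
within `N` passes. -/
def oslaLoop (d : ℝ → ℝ) (p q lam : ℝ) : ℕ → ℝ → Option (ℝ × Set (ℕ × ℕ))
  | 0, _ => none
  | N + 1, h =>
    if g d p q lam h = h then some (g d p q lam h, placementSet d p q lam h)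
    else oslaLoop d p q lam N (g d p q lam h)

end RelayPlacement

end

/-!
Write `v x` for the probability that a path without placements visits `x` and continues, and
`gain a x = p * (lam + a) - Δ_q x` for the profit from postponing the placement at `x` by one step
when every renewal costs `a`.

*Renewal cost.* The differences `Δ_q` are nondecreasing in both coordinates (convexity of `d`, and
the sign of the mixed derivative), so each region `C` of the iteration is a lower set, and a path to
a point of `C` stays in `C`. Balance of flow then turns the lattice path formula into
`p * (∑_C v) * (renewalCost C - a) = lam + d 0 - ∑_C v * gain a` (`IsRegion.renewalCost_eq`), where
`v` does not depend on `C`. The region of `h` consists of the points with positive gain at level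
`h`, and the origin, hence it maximizes `∑_C v * gain h` (`IsHopCost.visitSum_gain_le`). It follows
that `g (g h) ≤ g h`, and that a fixed point of `g` is a lower bound of `g`. Below a given level `g`
takes finitely many values, because the path can visit only finitely many points of a region; so
the iteration reaches a fixed point (`IsHopCost.exists_oslaLoop_eq`).

*Optimality.* At a fixed point `h`, let `value x = lam + d x + h - ∑_y v y * (gain h (x + y))⁺`.
This function solves the optimality equation of the decision process, with value `h` at the origin
and with the one-step-look-ahead rule as minimizing action, since the placement set is closed under
steps. The look-ahead policy therefore costs at most `value`. Conversely, along any policy of finite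
cost the expected value of the current state tends to zero: the path ends with probability `p` at
each step, independently of the position, so this expectation is dominated by a multiple of the
expected cost of the current stage, the term of a convergent series
(`IsHopCost.expect_law_stateValue_le`). Hence `value` is the optimal cost-to-go
(`IsHopCost.optCost_eq`).
-/

noncomputable section

namespace RelayPlacement

open Filter Topology

/-! ### Monotonicity of the one-step differences -/

theorem IsHopCost.continuousOn {d : ℝ → ℝ} (hd : IsHopCost d) : ContinuousOn d (Set.Ici 0) := by
  have hint : ContinuousOn d (Set.Ioi 0) := by
    simpa using hd.convex.continuousOn_interior
  intro x hx
  rcases (Set.mem_Ici.1 hx).eq_or_lt with rfl | hx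
  · -- near `0`, convexity and monotonicity give `d 0 ≤ d t ≤ d 0 + t * (d 1 - d 0)`
    have h1 : Tendsto (fun t : ℝ => d 0 + t * (d 1 - d 0)) (𝓝[Set.Ici 0] 0) (𝓝 (d 0)) := by
      have : Tendsto (fun t : ℝ => d 0 + t * (d 1 - d 0)) (𝓝 0) (𝓝 (d 0 + 0 * (d 1 - d 0))) :=
        Continuous.tendsto (by fun_prop) 0
      simpa using this.mono_left nhdsWithin_le_nhds
    refine tendsto_of_tendsto_of_tendsto_of_le_of_le' tendsto_const_nhds h1 ?_ ?_
    · filter_upwards [self_mem_nhdsWithin] with t ht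
      exact hd.increasing (Set.mem_Ici.2 le_rfl) ht ht
    · have hlt : ∀ᶠ t : ℝ in 𝓝[Set.Ici 0] 0, t < 1 :=
        nhdsWithin_le_nhds (Iio_mem_nhds one_pos)
      filter_upwards [self_mem_nhdsWithin, hlt] with t ht ht1
      have ht0 : 0 ≤ t := ht
      have := hd.convex.2 (Set.mem_Ici.2 le_rfl) (Set.mem_Ici.2 zero_le_one)
        (sub_nonneg.2 ht1.le) ht0 (by ring)
      simp only [smul_eq_mul, mul_zero, mul_one, zero_add] at this
      linarith
  · exact (hint.continuousAt (Ioi_mem_nhds hx)).continuousWithinAt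

theorem hop_comm (d : ℝ → ℝ) (x y : ℝ) : hop d x y = hop d y x := by
  simp [hop, add_comm]

theorem IsHopCost.continuous_hop {d : ℝ → ℝ} (hd : IsHopCost d) :
    Continuous fun z : ℝ × ℝ => hop d z.1 z.2 :=
  hd.continuousOn.comp_continuous (f := fun z : ℝ × ℝ => Real.sqrt (z.1 ^ 2 + z.2 ^ 2))
    (by fun_prop) fun _ => Real.sqrt_nonneg _

theorem IsHopCost.hop_mono {d : ℝ → ℝ} (hd : IsHopCost d) {x x' y : ℝ} (hx : 0 ≤ x)
    (h : x ≤ x') : hop d x y ≤ hop d x' y :=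
  hd.increasing (Real.sqrt_nonneg _) (Real.sqrt_nonneg _) (Real.sqrt_le_sqrt (by gcongr))

theorem hop_zero_right (d : ℝ → ℝ) {x : ℝ} (hx : 0 ≤ x) : hop d x 0 = d x := by
  simp [hop, Real.sqrt_sq hx]

theorem IsHopCost.le_hop {d : ℝ → ℝ} (hd : IsHopCost d) (x y : ℝ) : d 0 ≤ hop d x y :=
  hd.increasing (Set.mem_Ici.2 le_rfl) (Real.sqrt_nonneg _) (Real.sqrt_nonneg _)

theorem IsHopCost.hop_pos {d : ℝ → ℝ} (hd : IsHopCost d) (x y : ℝ) : 0 < hop d x y :=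
  hd.pos_zero.trans_le (hd.le_hop x y)

/-- The one-hop cost is midpoint convex in each coordinate, being a nondecreasing convex function
of a norm. -/
theorem IsHopCost.hop_midpoint {d : ℝ → ℝ} (hd : IsHopCost d) (x y : ℝ) :
    2 * hop d (x + 1) y ≤ hop d x y + hop d (x + 1 + 1) y := by
  set a := Real.sqrt (x ^ 2 + y ^ 2)
  set b := Real.sqrt ((x + 1 + 1) ^ 2 + y ^ 2)
  have ha : 0 ≤ a := Real.sqrt_nonneg _
  have hb : 0 ≤ b := Real.sqrt_nonneg _
  have ha2 : a ^ 2 = x ^ 2 + y ^ 2 := Real.sq_sqrt (by positivity)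
  have hb2 : b ^ 2 = (x + 1 + 1) ^ 2 + y ^ 2 := Real.sq_sqrt (by positivity)
  have hab : x * (x + 1 + 1) + y ^ 2 ≤ a * b := by
    refine (abs_le_of_sq_le_sq' ?_ (mul_nonneg ha hb)).2
    rw [mul_pow, ha2, hb2]
    nlinarith [sq_nonneg y]
  have hr : Real.sqrt ((x + 1) ^ 2 + y ^ 2) ≤ (1 / 2) * a + (1 / 2) * b := by
    refine Real.sqrt_le_iff.2 ⟨by positivity, ?_⟩
    nlinarith
  have h1 := hd.increasing (Real.sqrt_nonneg _) (Set.mem_Ici.2 (by positivity)) hr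
  have h2 := hd.convex.2 (Set.mem_Ici.2 ha) (Set.mem_Ici.2 hb)
    (by norm_num : (0 : ℝ) ≤ 1 / 2) (by norm_num : (0 : ℝ) ≤ 1 / 2) (by norm_num)
  simp only [smul_eq_mul] at h2
  change 2 * d (Real.sqrt ((x + 1) ^ 2 + y ^ 2)) ≤ d a + d b
  linarith

/-- The one-hop cost has increasing differences in the open quadrant, since its mixed derivative
is nonnegative there. -/
theorem IsHopCost.hop_supermodular_of_pos {d : ℝ → ℝ} (hd : IsHopCost d) {x x' y y' : ℝ}
    (hx : 0 < x) (hy : 0 < y) (hxx : x ≤ x') (hyy : y ≤ y') :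
    hop d x' y - hop d x y ≤ hop d x' y' - hop d x y' := by
  set F : ℝ × ℝ → ℝ := fun z => hop d z.1 z.2 with hF
  set U : Set (ℝ × ℝ) := Set.Ioi 0 ×ˢ Set.Ioi 0 with hU
  have hUo : IsOpen U := isOpen_Ioi.prod isOpen_Ioi
  have hFd : ∀ z ∈ U, DifferentiableAt ℝ F z := fun z hz =>
    (hd.smooth.differentiableOn (by norm_num)).differentiableAt (hUo.mem_nhds hz)
  have hF1 : ContDiffOn ℝ 1 (fderiv ℝ F) U := hd.smooth.fderiv_of_isOpen hUo (by norm_num)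
  have hF1d : ∀ z ∈ U, DifferentiableAt ℝ (fderiv ℝ F) z := fun z hz =>
    (hF1.differentiableOn (by norm_num)).differentiableAt (hUo.mem_nhds hz)
  have hline : ∀ s t : ℝ, HasDerivAt (fun r : ℝ => (s, r)) ((0 : ℝ), (1 : ℝ)) t := fun s t =>
    (hasDerivAt_const t s).prodMk (hasDerivAt_id t)
  have hline' : ∀ s t : ℝ, HasDerivAt (fun r : ℝ => (r, t)) ((1 : ℝ), (0 : ℝ)) s := fun s t =>
    (hasDerivAt_id s).prodMk (hasDerivAt_const s t)
  have hdy : ∀ s t : ℝ, 0 < s → 0 < t →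
      HasDerivAt (fun r => hop d s r) (fderiv ℝ F (s, t) (0, 1)) t := fun s t hs ht =>
    (hFd (s, t) ⟨hs, ht⟩).hasFDerivAt.comp_hasDerivAt t (hline s t)
  -- the derivative in the second coordinate is nondecreasing in the first one
  have hmono : ∀ t : ℝ, 0 < t → MonotoneOn (fun s => deriv (fun r => hop d s r) t) (Set.Ioi 0) := by
    intro t ht
    have hdiff : ∀ s : ℝ, 0 < s →
        DifferentiableAt ℝ (fun s => deriv (fun r => hop d s r) t) s := by
      intro s hs
      have h1 : DifferentiableAt ℝ (fun s : ℝ => fderiv ℝ F (s, t) (0, 1)) s :=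
        ((hF1d (s, t) ⟨hs, ht⟩).comp s (hline' s t).differentiableAt).clm_apply
          (differentiableAt_const _)
      refine h1.congr_of_eventuallyEq ?_
      filter_upwards [Ioi_mem_nhds hs] with s' hs'
      exact (hdy s' t hs' ht).deriv
    refine monotoneOn_of_deriv_nonneg (convex_Ioi 0)
      (fun s hs => (hdiff s hs).continuousAt.continuousWithinAt) ?_ ?_
    · rw [interior_Ioi]
      exact fun s hs => (hdiff s hs).differentiableWithinAt
    · rw [interior_Ioi]
      exact fun s hs => hd.dxy_nonneg s t hs ht
  have hx' : 0 < x' := hx.trans_le hxx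
  have hdd : ∀ t : ℝ, 0 < t → HasDerivAt (fun r => hop d x' r - hop d x r)
      (deriv (fun r => hop d x' r) t - deriv (fun r => hop d x r) t) t := fun t ht =>
    (hdy x' t hx' ht).differentiableAt.hasDerivAt.sub (hdy x t hx ht).differentiableAt.hasDerivAt
  have : MonotoneOn (fun r => hop d x' r - hop d x r) (Set.Ioi 0) := by
    refine monotoneOn_of_deriv_nonneg (convex_Ioi 0)
      (fun s hs => (hdd s hs).continuousAt.continuousWithinAt) ?_ ?_
    · rw [interior_Ioi]
      exact fun s hs => (hdd s hs).differentiableAt.differentiableWithinAt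
    · rw [interior_Ioi]
      intro s hs
      rw [(hdd s hs).deriv]
      exact sub_nonneg.2 (hmono s hs hx hx' hxx)
  exact this hy (hy.trans_le hyy) hyy

theorem IsHopCost.hop_supermodular {d : ℝ → ℝ} (hd : IsHopCost d) {x x' y y' : ℝ}
    (hx : 0 ≤ x) (hy : 0 ≤ y) (hxx : x ≤ x') (hyy : y ≤ y') :
    hop d x' y - hop d x y ≤ hop d x' y' - hop d x y' := by
  have hc : ∀ a b : ℝ, Tendsto (fun e : ℝ => hop d (a + e) (b + e)) (𝓝[>] 0) (𝓝 (hop d a b)) := by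
    intro a b
    have h : Continuous fun e : ℝ => hop d (a + e) (b + e) :=
      hd.continuous_hop.comp (f := fun e : ℝ => (a + e, b + e)) (by fun_prop)
    simpa using (h.tendsto 0).mono_left nhdsWithin_le_nhds
  refine le_of_tendsto_of_tendsto ((hc x' y).sub (hc x y)) ((hc x' y').sub (hc x y')) ?_
  filter_upwards [self_mem_nhdsWithin] with e he
  have he : 0 < e := he
  exact hd.hop_supermodular_of_pos (by linarith) (by linarith) (by linarith) (by linarith)

theorem delta2_eq_delta1 (d : ℝ → ℝ) (m n : ℕ) : delta2 d m n = delta1 d n m := by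
  simp [delta1, delta2, hop_comm]

theorem IsHopCost.delta1_nonneg {d : ℝ → ℝ} (hd : IsHopCost d) (m n : ℕ) : 0 ≤ delta1 d m n :=
  sub_nonneg.2 (hd.hop_mono m.cast_nonneg (by linarith))

theorem IsHopCost.delta1_mono {d : ℝ → ℝ} (hd : IsHopCost d) {m m' n n' : ℕ} (hm : m ≤ m')
    (hn : n ≤ n') : delta1 d m n ≤ delta1 d m' n' := by
  have h1 : Monotone fun m => delta1 d m n := by
    refine monotone_nat_of_le_succ fun k => ?_
    have := hd.hop_midpoint k n
    simp only [delta1, Nat.cast_add, Nat.cast_one]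
    linarith
  exact (h1 hm).trans (hd.hop_supermodular m'.cast_nonneg n.cast_nonneg (by linarith)
    (Nat.cast_le.2 hn))

theorem IsHopCost.tendsto_delta1 {d : ℝ → ℝ} (hd : IsHopCost d) :
    Tendsto (fun m : ℕ => delta1 d m 0) atTop atTop := by
  refine ((hd.diff_tendsto 1 one_pos).comp tendsto_natCast_atTop_atTop).congr fun m => ?_
  have h : (0 : ℝ) ≤ m := m.cast_nonneg
  simp [delta1, hop_zero_right d h, hop_zero_right d (add_nonneg h zero_le_one)]

theorem IsHopCost.deltaq_nonneg {d : ℝ → ℝ} (hd : IsHopCost d) {q : ℝ} (hq0 : 0 ≤ q)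
    (hq1 : q ≤ 1) (m n : ℕ) : 0 ≤ deltaq d q m n := by
  have h1 := hd.delta1_nonneg m n
  have h2 := hd.delta1_nonneg n m
  rw [deltaq, delta2_eq_delta1]
  have := sub_nonneg.2 hq1
  positivity

theorem IsHopCost.deltaq_mono {d : ℝ → ℝ} (hd : IsHopCost d) {q : ℝ} (hq0 : 0 ≤ q)
    (hq1 : q ≤ 1) {m m' n n' : ℕ} (hm : m ≤ m') (hn : n ≤ n') :
    deltaq d q m n ≤ deltaq d q m' n' := by
  simp only [deltaq, delta2_eq_delta1]
  have := sub_nonneg.2 hq1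
  gcongr
  · exact hd.delta1_mono hm hn
  · exact hd.delta1_mono hn hm

/-! ### Visiting probabilities and the balance of flow -/

/-- The probability that the path, walking without any placement from `(0,0)`, visits `x` and has
not ended there. -/
def visit (p q : ℝ) (x : ℕ × ℕ) : ℝ :=
  (x.1 + x.2).choose x.1 * (1 - p) ^ (x.1 + x.2) * q ^ x.1 * (1 - q) ^ x.2

/-- The mass that moves to `y` in one step when mass `a x` leaves each point `x`. -/
def inflow (q : ℝ) (a : ℕ × ℕ → ℝ) (y : ℕ × ℕ) : ℝ :=
  (if 0 < y.1 then q * a (y.1 - 1, y.2) else 0) + if 0 < y.2 then (1 - q) * a (y.1, y.2 - 1) else 0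

/-- The mean of `φ` at the point reached by one step from `x`. -/
def stepMean (q : ℝ) (φ : ℕ × ℕ → ℝ) (x : ℕ × ℕ) : ℝ :=
  q * φ (x.1 + 1, x.2) + (1 - q) * φ (x.1, x.2 + 1)

/-- A continuation region on which the path can only spend a bounded time: bounded in each
direction in which the path moves with positive probability. For `q = 0` or `q = 1` it may be an
infinite set. -/
structure IsRegion (q : ℝ) (C : Set (ℕ × ℕ)) : Prop where
  lower : IsLowerSet C
  bdd : ∃ M : ℕ, ∀ x ∈ C, (q ≠ 0 → x.1 ≤ M) ∧ (q ≠ 1 → x.2 ≤ M)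

/-- The expected sum of `φ` over the points of `C` that the path visits; `C` is meant to be a
lower set, so that a path to a point of `C` stays in `C`. -/
def visitSum (p q : ℝ) (C : Set (ℕ × ℕ)) (φ : ℕ × ℕ → ℝ) : ℝ :=
  ∑' x, C.indicator (visit p q) x * φ x

theorem visit_nonneg {p q : ℝ} (hp1 : p ≤ 1) (hq0 : 0 ≤ q) (hq1 : q ≤ 1) (x : ℕ × ℕ) :
    0 ≤ visit p q x := by
  have h1 := sub_nonneg.2 hp1
  have h2 := sub_nonneg.2 hq1
  unfold visit
  positivity

theorem visit_zero (p q : ℝ) : visit p q (0, 0) = 1 := by simp [visit]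

theorem IsRegion.finite_support {q : ℝ} {C : Set (ℕ × ℕ)} (hC : IsRegion q C) (p : ℝ) :
    (Function.support (C.indicator (visit p q))).Finite := by
  obtain ⟨M, hM⟩ := hC.bdd
  refine (Set.finite_Iic ((M, M) : ℕ × ℕ)).subset fun x hx => ?_
  have hxC : x ∈ C := Set.mem_of_indicator_ne_zero hx
  have hv : visit p q x ≠ 0 := by
    rwa [Function.mem_support, Set.indicator_of_mem hxC] at hx
  refine ⟨?_, ?_⟩
  · by_cases hq : q = 0
    · subst hq
      by_contra h
      have : x.1 ≠ 0 := by rintro h0; simp [h0] at h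
      exact hv (by simp [visit, this])
    · exact (hM x hxC).1 hq
  · by_cases hq : q = 1
    · subst hq
      by_contra h
      have : x.2 ≠ 0 := by rintro h0; simp [h0] at h
      exact hv (by simp [visit, this])
    · exact (hM x hxC).2 hq

theorem summable_mul_of_finite_support {a : ℕ × ℕ → ℝ} (ha : (Function.support a).Finite)
    (φ : ℕ × ℕ → ℝ) : Summable fun x => a x * φ x :=
  summable_of_hasFiniteSupport (ha.subset (Function.support_mul_subset_left a φ))

theorem finite_support_inflow_west {a : ℕ × ℕ → ℝ} (ha : (Function.support a).Finite) (q : ℝ) :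
    (Function.support fun y : ℕ × ℕ => if 0 < y.1 then q * a (y.1 - 1, y.2) else 0).Finite := by
  refine (ha.image fun x => (x.1 + 1, x.2)).subset ?_
  rintro ⟨m, n⟩ h
  rcases Nat.eq_zero_or_pos m with rfl | hm
  · simp at h
  · refine ⟨(m - 1, n), ?_, by ext <;> simp; omega⟩
    simp only [Function.mem_support, hm, if_true] at h
    exact right_ne_zero_of_mul h

theorem finite_support_inflow_south {a : ℕ × ℕ → ℝ} (ha : (Function.support a).Finite) (q : ℝ) :
    (Function.support fun y : ℕ × ℕ =>
      if 0 < y.2 then (1 - q) * a (y.1, y.2 - 1) else 0).Finite := by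
  refine (ha.image fun x => (x.1, x.2 + 1)).subset ?_
  rintro ⟨m, n⟩ h
  rcases Nat.eq_zero_or_pos n with rfl | hm
  · simp at h
  · refine ⟨(m, n - 1), ?_, by ext <;> simp; omega⟩
    simp only [Function.mem_support, hm, if_true] at h
    exact right_ne_zero_of_mul h

theorem finite_support_inflow {a : ℕ × ℕ → ℝ} (ha : (Function.support a).Finite) (q : ℝ) :
    (Function.support (inflow q a)).Finite :=
  ((finite_support_inflow_west ha q).union (finite_support_inflow_south ha q)).subset
    (Function.support_add _ _)

/-- Balance of flow: the mean of `φ` after one step can be computed by source or by target. -/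
theorem tsum_mul_stepMean {a : ℕ × ℕ → ℝ} (ha : (Function.support a).Finite) (q : ℝ)
    (φ : ℕ × ℕ → ℝ) : ∑' x, a x * stepMean q φ x = ∑' y, inflow q a y * φ y := by
  have e1 : ∑' x : ℕ × ℕ, a x * (q * φ (x.1 + 1, x.2)) =
      ∑' y : ℕ × ℕ, (if 0 < y.1 then q * a (y.1 - 1, y.2) else 0) * φ y := by
    rw [← Function.Injective.tsum_eq (g := fun x : ℕ × ℕ => (x.1 + 1, x.2))
      (f := fun y : ℕ × ℕ => (if 0 < y.1 then q * a (y.1 - 1, y.2) else 0) * φ y)]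
    · exact tsum_congr fun x => by simp; ring
    · rintro ⟨a, b⟩ ⟨c, e⟩ h
      simpa using h
    · rintro ⟨m, n⟩ h
      rcases Nat.eq_zero_or_pos m with rfl | hm
      · simp at h
      · exact ⟨(m - 1, n), by ext <;> simp; omega⟩
  have e2 : ∑' x : ℕ × ℕ, a x * ((1 - q) * φ (x.1, x.2 + 1)) =
      ∑' y : ℕ × ℕ, (if 0 < y.2 then (1 - q) * a (y.1, y.2 - 1) else 0) * φ y := by
    rw [← Function.Injective.tsum_eq (g := fun x : ℕ × ℕ => (x.1, x.2 + 1))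
      (f := fun y : ℕ × ℕ => (if 0 < y.2 then (1 - q) * a (y.1, y.2 - 1) else 0) * φ y)]
    · exact tsum_congr fun x => by simp; ring
    · rintro ⟨a, b⟩ ⟨c, e⟩ h
      simpa using h
    · rintro ⟨m, n⟩ h
      rcases Nat.eq_zero_or_pos n with rfl | hm
      · simp at h
      · exact ⟨(m, n - 1), by ext <;> simp; omega⟩
  simp only [stepMean, inflow, mul_add, add_mul]
  rw [(summable_mul_of_finite_support ha _).tsum_add (summable_mul_of_finite_support ha _), e1, e2,
    (summable_mul_of_finite_support (finite_support_inflow_west ha q) φ).tsum_add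
      (summable_mul_of_finite_support (finite_support_inflow_south ha q) φ)]

/-- The expected sum over a region is a finite sum, in a way that is uniform in the summand. -/
theorem IsRegion.exists_finset {q : ℝ} {C : Set (ℕ × ℕ)} (hC : IsRegion q C) (p : ℝ) :
    ∃ D : Finset (ℕ × ℕ), ∀ φ, visitSum p q C φ = ∑ x ∈ D, visit p q x * φ x := by
  refine ⟨(hC.finite_support p).toFinset, fun φ => ?_⟩
  rw [visitSum, tsum_eq_sum (s := (hC.finite_support p).toFinset)]
  · refine Finset.sum_congr rfl fun x hx => ?_
    rw [Set.indicator_of_mem]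
    exact Set.mem_of_indicator_ne_zero ((hC.finite_support p).mem_toFinset.1 hx)
  · intro x hx
    rw [Set.Finite.mem_toFinset, Function.mem_support, not_not] at hx
    rw [hx, zero_mul]

theorem inflow_zero (q : ℝ) (a : ℕ × ℕ → ℝ) : inflow q a (0, 0) = 0 := by simp [inflow]

theorem inflow_eq_zero {C : Set (ℕ × ℕ)} {p q : ℝ} {y : ℕ × ℕ}
    (hy : y ∉ C) (hyB : y ∉ boundary C) : inflow q (C.indicator (visit p q)) y = 0 := by
  have h : ¬ (WestIn C y ∨ SouthIn C y) := fun h => hyB ⟨hy, h⟩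
  rw [not_or] at h
  have h1 : 0 < y.1 → (y.1 - 1, y.2) ∉ C := fun h0 hc => h.1 ⟨h0, hc⟩
  have h2 : 0 < y.2 → (y.1, y.2 - 1) ∉ C := fun h0 hc => h.2 ⟨h0, hc⟩
  unfold inflow
  split_ifs with h3 h4 h4 <;> simp_all

/-- The closed formula `pathCount` counts the lattice paths that stay in `C` up to their last
step: it is consistent with the flow out of `C`. -/
theorem inflow_eq_pathCount {q : ℝ} {C : Set (ℕ × ℕ)} (hC : IsLowerSet C) (p : ℝ) {y : ℕ × ℕ}
    (hy : y ∈ C ∪ boundary C) (hy0 : y ≠ (0, 0)) :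
    inflow q (C.indicator (visit p q)) y =
      pathCount C y * (1 - p) ^ (y.1 + y.2 - 1) * q ^ y.1 * (1 - q) ^ y.2 := by
  classical
  have hnb : ∀ x ∈ C, x ∉ boundary C := fun x hx hb => hb.1 hx
  obtain ⟨m, n⟩ := y
  rcases m with _ | m <;> rcases n with _ | n
  · exact absurd rfl hy0
  · have hS : (0, n) ∈ C := by
      rcases hy with hy | ⟨-, h | h⟩
      · exact hC (by simp) hy
      · exact absurd h.1 (lt_irrefl _)
      · exact h.2
    have hcount : pathCount C (0, n + 1) = 1 := by
      simp [pathCount, WestIn, SouthIn, hnb _ hS]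
    rw [hcount]
    simp [inflow, Set.indicator_of_mem hS, visit, pow_succ]
    ring
  · have hW : (m, 0) ∈ C := by
      rcases hy with hy | ⟨-, h | h⟩
      · exact hC (by simp) hy
      · exact h.2
      · exact absurd h.1 (lt_irrefl _)
    have hcount : pathCount C (m + 1, 0) = 1 := by
      simp [pathCount, WestIn, SouthIn, hnb _ hW]
    rw [hcount]
    simp [inflow, Set.indicator_of_mem hW, visit, pow_succ]
    ring
  · have e1 : m + (n + 1) = m + n + 1 := by ring
    have e2 : m + 1 + n = m + n + 1 := by ring
    have e3 : m + 1 + (n + 1) = m + n + 1 + 1 := by ring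
    have hin : inflow q (C.indicator (visit p q)) (m + 1, n + 1) =
        ((if (m, n + 1) ∈ C then ((m + n + 1).choose m : ℝ) else 0) +
          if (m + 1, n) ∈ C then ((m + n + 1).choose (m + 1) : ℝ) else 0) *
          (1 - p) ^ (m + n + 1) * q ^ (m + 1) * (1 - q) ^ (n + 1) := by
      simp only [inflow, Nat.succ_pos, if_true, Set.indicator_apply, visit, Nat.add_sub_cancel,
        e1, e2]
      split_ifs <;> ring
    rw [hin]
    simp only [e3, Nat.add_sub_cancel]
    congr 3
    rcases hy with hy | hy
    · have hW : (m, n + 1) ∈ C := hC (by simp) hy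
      have hS : (m + 1, n) ∈ C := hC (by simp) hy
      have : pathCount C (m + 1, n + 1) = (m + n + 1 + 1).choose (m + 1) := by
        simp [pathCount, hnb _ hy, e3]
      rw [this, if_pos hW, if_pos hS, Nat.choose_succ_succ' (m + n + 1) m, Nat.cast_add]
    · by_cases hW : (m, n + 1) ∈ C <;> by_cases hS : (m + 1, n) ∈ C
      · have : pathCount C (m + 1, n + 1) = (m + n + 1 + 1).choose (m + 1) := by
          simp [pathCount, WestIn, SouthIn, hnb _ hW, hnb _ hS, e3]
        rw [this, if_pos hW, if_pos hS, Nat.choose_succ_succ' (m + n + 1) m, Nat.cast_add]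
      · have hSB : (m + 1, n) ∈ boundary C :=
          ⟨hS, Or.inl ⟨Nat.succ_pos _, hC (b := (m, n)) (a := (m, n + 1)) (by simp) hW⟩⟩
        have : pathCount C (m + 1, n + 1) = (m + n + 1).choose m := by
          simp [pathCount, WestIn, SouthIn, hnb _ hW, hSB, hy, e3]
        rw [this, if_pos hW, if_neg hS, add_zero]
      · have hWB : (m, n + 1) ∈ boundary C :=
          ⟨hW, Or.inr ⟨Nat.succ_pos _, hC (b := (m, n)) (a := (m + 1, n)) (by simp) hS⟩⟩
        have : pathCount C (m + 1, n + 1) = (m + n + 1).choose (m + 1) := by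
          simp [pathCount, WestIn, hWB, hy, e3]
        rw [this, if_neg hW, if_pos hS, zero_add]
      · rcases hy.2 with h | h
        · exact absurd h.2 hW
        · exact absurd h.2 hS

theorem visit_eq_inflow (p q : ℝ) {C : Set (ℕ × ℕ)} (hC : IsLowerSet C) {y : ℕ × ℕ} (hy : y ∈ C)
    (hy0 : y ≠ (0, 0)) :
    visit p q y = (1 - p) * inflow q (C.indicator (visit p q)) y := by
  rw [inflow_eq_pathCount hC p (Or.inl hy) hy0]
  have h1 : pathCount C y = (y.1 + y.2).choose y.1 := by
    have : y ∉ boundary C := fun h => h.1 hy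
    simp [pathCount, this]
  have h2 : y.1 + y.2 = y.1 + y.2 - 1 + 1 := by
    have : ¬ (y.1 = 0 ∧ y.2 = 0) := fun h => hy0 (Prod.ext h.1 h.2)
    omega
  rw [h1, visit]
  conv_lhs => rw [h2, pow_succ, ← h2]
  ring

/-- First-step decomposition of the expected sum of a function supported in the region. -/
theorem IsRegion.visitSum_eq {q : ℝ} {C : Set (ℕ × ℕ)} (hC : IsRegion q C) (p : ℝ)
    {φ : ℕ × ℕ → ℝ} (hφ : ∀ x ∉ C, φ x = 0) :
    visitSum p q C φ = φ (0, 0) + (1 - p) * visitSum p q C (stepMean q φ) := by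
  classical
  have hfs := hC.finite_support p
  rw [visitSum, visitSum, tsum_mul_stepMean hfs, ← tsum_mul_left,
    ← tsum_ite_eq ((0, 0) : ℕ × ℕ) (fun _ => φ (0, 0)), ← Summable.tsum_add]
  · refine tsum_congr fun y => ?_
    by_cases hy0 : y = (0, 0)
    · subst hy0
      by_cases h0 : ((0, 0) : ℕ × ℕ) ∈ C
      · simp [inflow_zero, Set.indicator_of_mem h0, visit_zero]
      · simp [hφ _ h0]
    · by_cases hy : y ∈ C
      · rw [Set.indicator_of_mem hy, visit_eq_inflow p q hC.lower hy hy0, if_neg hy0]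
        ring
      · simp [hφ _ hy, hy0]
  · exact (hasSum_ite_eq _ _).summable
  · exact (summable_mul_of_finite_support (finite_support_inflow hfs q) φ).mul_left _

theorem IsRegion.tsum_endProb {q : ℝ} {C : Set (ℕ × ℕ)} (hC : IsRegion q C) (p : ℝ)
    (φ : ℕ × ℕ → ℝ) :
    ∑' x : (C ∪ boundary C : Set (ℕ × ℕ)), endProb p q C x * φ x =
      p * visitSum p q C (stepMean q φ) := by
  rw [visitSum, tsum_mul_stepMean (hC.finite_support p), ← tsum_mul_left,
    tsum_subtype (C ∪ boundary C) (fun x => endProb p q C x * φ x)]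
  refine tsum_congr fun y => ?_
  by_cases hy : y ∈ C ∪ boundary C
  · rw [Set.indicator_of_mem hy]
    by_cases hy0 : y = (0, 0)
    · subst hy0
      simp [endProb, inflow_zero]
    · rw [inflow_eq_pathCount hC.lower p hy hy0, endProb, if_neg hy0]
      ring
  · rw [Set.indicator_of_notMem hy, inflow_eq_zero (fun h => hy (Or.inl h))
      (fun h => hy (Or.inr h))]
    ring

theorem IsRegion.tsum_contProb {q : ℝ} {C : Set (ℕ × ℕ)} (hC : IsRegion q C) (h0 : (0, 0) ∈ C)
    (p : ℝ) (φ : ℕ × ℕ → ℝ) :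
    ∑' x : boundary C, contProb p q C x * φ x =
      (1 - p) * visitSum p q C (stepMean q φ) - visitSum p q C φ + φ (0, 0) := by
  classical
  have hfs := hC.finite_support p
  rw [visitSum, visitSum, tsum_mul_stepMean hfs, ← tsum_mul_left,
    ← tsum_ite_eq ((0, 0) : ℕ × ℕ) (fun _ => φ (0, 0)), ← Summable.tsum_sub,
    ← Summable.tsum_add, tsum_subtype (boundary C) (fun x => contProb p q C x * φ x)]
  · refine tsum_congr fun y => ?_
    by_cases hyC : y ∈ C
    · rw [Set.indicator_of_notMem (fun h => h.1 hyC), Set.indicator_of_mem hyC]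
      by_cases hy0 : y = (0, 0)
      · subst hy0
        simp [inflow_zero, visit_zero]
      · rw [visit_eq_inflow p q hC.lower hyC hy0, if_neg hy0]
        ring
    · have hy0 : y ≠ (0, 0) := fun h => hyC (h ▸ h0)
      rw [Set.indicator_of_notMem hyC, if_neg hy0]
      by_cases hyB : y ∈ boundary C
      · rw [Set.indicator_of_mem hyB, inflow_eq_pathCount hC.lower p (Or.inr hyB) hy0, contProb]
        have h2 : y.1 + y.2 = y.1 + y.2 - 1 + 1 := by
          have : ¬ (y.1 = 0 ∧ y.2 = 0) := fun h => hy0 (Prod.ext h.1 h.2)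
          omega
        conv_lhs => rw [h2, pow_succ]
        ring
      · rw [Set.indicator_of_notMem hyB, inflow_eq_zero hyC hyB]
        ring
  · exact ((summable_mul_of_finite_support (finite_support_inflow hfs q) φ).mul_left _).sub
      (summable_mul_of_finite_support hfs φ)
  · exact (hasSum_ite_eq _ _).summable
  · exact (summable_mul_of_finite_support (finite_support_inflow hfs q) φ).mul_left _
  · exact summable_mul_of_finite_support hfs φ

/-! ### The renewal cost and the iteration -/

/-- The reward for postponing the placement from `x` by one step when the cost of each renewal
is `h`. It is positive exactly off `placementSet d p q lam h`. -/
def gain (d : ℝ → ℝ) (p q lam h : ℝ) (x : ℕ × ℕ) : ℝ := p * (lam + h) - deltaq d q x.1 x.2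

theorem mem_placementSet_iff {d : ℝ → ℝ} {p q lam h : ℝ} {x : ℕ × ℕ} :
    x ∈ placementSet d p q lam h ↔ gain d p q lam h x ≤ 0 := by
  simp [placementSet, gain]

theorem stepMean_hop (d : ℝ → ℝ) (q c : ℝ) (x : ℕ × ℕ) :
    stepMean q (fun y => c + hop d y.1 y.2) x = c + hop d x.1 x.2 + deltaq d q x.1 x.2 := by
  simp only [stepMean, deltaq, delta1, delta2, Nat.cast_add, Nat.cast_one]
  ring

theorem visitSum_one_pos {p q : ℝ} (hp1 : p ≤ 1) (hq0 : 0 ≤ q) (hq1 : q ≤ 1) {C : Set (ℕ × ℕ)}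
    (hC : IsRegion q C) (h0 : (0, 0) ∈ C) : 0 < visitSum p q C fun _ => 1 := by
  refine (summable_mul_of_finite_support (hC.finite_support p) _).tsum_pos (fun x => ?_) (0, 0) ?_
  · exact mul_nonneg (Set.indicator_nonneg (fun x _ => visit_nonneg hp1 hq0 hq1 x) _) zero_le_one
  · rw [Set.indicator_of_mem h0, visit_zero]
    norm_num

/-- The probability that the path ends before it leaves the region is `p` times the expected
number of points of the region that it visits. -/
theorem IsRegion.tsum_contProb_one {q : ℝ} {C : Set (ℕ × ℕ)} (hC : IsRegion q C)
    (h0 : (0, 0) ∈ C) (p : ℝ) :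
    ∑' x : boundary C, contProb p q C x = 1 - p * visitSum p q C (fun _ => 1) := by
  have := hC.tsum_contProb h0 p (fun _ => 1)
  simp only [mul_one] at this
  rw [this]
  have : stepMean q (fun _ => (1 : ℝ)) = fun _ => 1 := by
    funext x
    simp [stepMean]
  rw [this]
  ring

theorem IsRegion.mul_visitSum_one_le {p q : ℝ} (hp1 : p ≤ 1) (hq0 : 0 ≤ q) (hq1 : q ≤ 1)
    {C : Set (ℕ × ℕ)} (hC : IsRegion q C) (h0 : (0, 0) ∈ C) :
    p * visitSum p q C (fun _ => 1) ≤ 1 := by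
  have h := hC.tsum_contProb_one h0 p
  have : 0 ≤ ∑' x : boundary C, contProb p q C x := tsum_nonneg fun x => by
    have h1 := sub_nonneg.2 hp1
    have h2 := sub_nonneg.2 hq1
    unfold contProb
    positivity
  linarith

theorem IsRegion.visitSum_mono {p q : ℝ} (hp1 : p ≤ 1) (hq0 : 0 ≤ q) (hq1 : q ≤ 1)
    {C : Set (ℕ × ℕ)} (hC : IsRegion q C) {φ ψ : ℕ × ℕ → ℝ} (h : ∀ x, φ x ≤ ψ x) :
    visitSum p q C φ ≤ visitSum p q C ψ :=
  Summable.tsum_le_tsum (fun x => mul_le_mul_of_nonneg_left (h x)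
      (Set.indicator_nonneg (fun x _ => visit_nonneg hp1 hq0 hq1 x) _))
    (summable_mul_of_finite_support (hC.finite_support p) _)
    (summable_mul_of_finite_support (hC.finite_support p) _)

theorem visitSum_const (p q : ℝ) (C : Set (ℕ × ℕ)) (c : ℝ) :
    visitSum p q C (fun _ => c) = c * visitSum p q C fun _ => 1 := by
  simp only [visitSum, ← tsum_mul_left]
  exact tsum_congr fun x => by ring

/-- The renewal cost of a region balances the placement cost at the origin with the gains of the
points at which placement is postponed: the right-hand side vanishes for `a` equal to the renewal
cost, and it depends on the region only through the domain of summation. -/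
theorem IsRegion.renewalCost_eq {q : ℝ} {C : Set (ℕ × ℕ)} (hC : IsRegion q C) (h0 : (0, 0) ∈ C)
    {p : ℝ} (hp0 : 0 < p) (hp1 : p ≤ 1) (hq0 : 0 ≤ q) (hq1 : q ≤ 1) (d : ℝ → ℝ) (lam a : ℝ) :
    p * visitSum p q C (fun _ => 1) * (renewalCost d p q lam C - a) =
      lam + d 0 - visitSum p q C (gain d p q lam a) := by
  have hS := visitSum_one_pos hp1 hq0 hq1 hC h0
  have hcont := hC.tsum_contProb_one h0 p
  have hend := hC.tsum_endProb p (fun y => 0 + hop d y.1 y.2)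
  have hcd := hC.tsum_contProb h0 p (fun y => lam + hop d y.1 y.2)
  simp only [zero_add] at hend
  rw [renewalCost, hcont, hend, hcd]
  have hz : hop d ((0 : ℕ) : ℝ) ((0 : ℕ) : ℝ) = d 0 := by simp [hop]
  rw [hz]
  have hm0 := stepMean_hop d q 0
  simp only [zero_add] at hm0
  have hm1 := stepMean_hop d q lam
  obtain ⟨D, hD⟩ := hC.exists_finset p
  have hne : p * ∑ x ∈ D, visit p q x * 1 ≠ 0 := by
    rw [← hD]
    positivity
  simp only [hD, hm0, hm1, gain, sub_sub_cancel] at *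
  rw [mul_sub, ← mul_assoc, mul_one_div_cancel hne, one_mul]
  simp only [mul_add, mul_sub, mul_one, Finset.sum_add_distrib, Finset.sum_sub_distrib,
    ← Finset.sum_mul]
  ring

section

variable {d : ℝ → ℝ} {p q lam : ℝ}

theorem IsHopCost.gain_anti (hd : IsHopCost d) (hq0 : 0 ≤ q) (hq1 : q ≤ 1) (p lam h : ℝ)
    {x y : ℕ × ℕ} (hxy : x ≤ y) : gain d p q lam h y ≤ gain d p q lam h x :=
  sub_le_sub_left (hd.deltaq_mono hq0 hq1 hxy.1 hxy.2) _

theorem zero_mem_contSet (d : ℝ → ℝ) (p q lam h : ℝ) : (0, 0) ∈ contSet d p q lam h :=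
  Or.inr rfl

theorem gain_pos_of_mem {h : ℝ} {x : ℕ × ℕ} (hx : x ∈ contSet d p q lam h) (hx0 : x ≠ (0, 0)) :
    0 < gain d p q lam h x := by
  rcases hx with hx | hx
  · exact not_le.1 fun hle => hx (mem_placementSet_iff.2 hle)
  · exact absurd hx hx0

theorem gain_nonpos_of_notMem {h : ℝ} {x : ℕ × ℕ} (hx : x ∉ contSet d p q lam h) :
    gain d p q lam h x ≤ 0 := by
  by_contra hcon
  exact hx (Or.inl fun hm => hcon (mem_placementSet_iff.1 hm))

theorem mem_contSet_of_gain_pos {h : ℝ} {x : ℕ × ℕ} (hx : 0 < gain d p q lam h x) :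
    x ∈ contSet d p q lam h := by
  by_contra hcon
  exact not_lt.2 (gain_nonpos_of_notMem hcon) hx

theorem IsHopCost.isRegion_contSet (hd : IsHopCost d) (hq0 : 0 ≤ q) (hq1 : q ≤ 1)
    (p lam h : ℝ) : IsRegion q (contSet d p q lam h) := by
  refine ⟨fun x y hyx hx => ?_, ?_⟩
  · by_cases hx0 : x = (0, 0)
    · have : y = (0, 0) := by
        subst hx0
        exact Prod.ext (Nat.le_zero.1 hyx.1) (Nat.le_zero.1 hyx.2)
      rw [this]
      exact zero_mem_contSet d p q lam h
    · exact mem_contSet_of_gain_pos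
        ((gain_pos_of_mem hx hx0).trans_le (hd.gain_anti hq0 hq1 p lam h hyx))
  · -- `Δ_q x` is at least `q Δ₁(x.1, 0)` and at least `(1 - q) Δ₁(x.2, 0)`, which tend to infinity
    -- unless the factor is zero
    have key : ∀ r : ℝ, 0 ≤ r → ∃ M : ℕ, r ≠ 0 → ∀ m, M < m → p * (lam + h) ≤ r * delta1 d m 0 := by
      intro r hr
      by_cases hr0 : r = 0
      · exact ⟨0, fun h => absurd hr0 h⟩
      · have := hd.tendsto_delta1.const_mul_atTop (lt_of_le_of_ne hr (Ne.symm hr0))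
        obtain ⟨M, hM⟩ := eventually_atTop.1 (this.eventually_ge_atTop (p * (lam + h)))
        exact ⟨M, fun _ m hm => hM m hm.le⟩
    obtain ⟨M₁, hM₁⟩ := key q hq0
    obtain ⟨M₂, hM₂⟩ := key (1 - q) (sub_nonneg.2 hq1)
    refine ⟨max M₁ M₂, fun x hx => ?_⟩
    by_cases hx0 : x = (0, 0)
    · simp [hx0]
    have hpos := gain_pos_of_mem hx hx0
    rw [gain, deltaq, delta2_eq_delta1] at hpos
    have h1 : delta1 d x.1 0 ≤ delta1 d x.1 x.2 := hd.delta1_mono le_rfl (Nat.zero_le _)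
    have h2 : delta1 d x.2 0 ≤ delta1 d x.2 x.1 := hd.delta1_mono le_rfl (Nat.zero_le _)
    have h3 := mul_le_mul_of_nonneg_left h1 hq0
    have h4 := mul_le_mul_of_nonneg_left h2 (sub_nonneg.2 hq1)
    have h5 := mul_nonneg hq0 (hd.delta1_nonneg x.1 0)
    have h6 := mul_nonneg (sub_nonneg.2 hq1) (hd.delta1_nonneg x.2 0)
    constructor
    · intro hq
      by_contra hcon
      have := hM₁ hq x.1 (lt_of_le_of_lt (le_max_left _ _) (not_le.1 hcon))
      linarith
    · intro hq
      by_contra hcon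
      have := hM₂ (sub_ne_zero.2 (Ne.symm hq)) x.2
        (lt_of_le_of_lt (le_max_right _ _) (not_le.1 hcon))
      linarith

theorem contSet_mono (hp0 : 0 ≤ p) {h h' : ℝ} (hh : h ≤ h') :
    contSet d p q lam h ⊆ contSet d p q lam h' := by
  rintro x (hx | hx)
  · refine Or.inl fun hx' => hx ?_
    exact le_trans (by gcongr) (show p * (lam + h') ≤ deltaq d q x.1 x.2 from hx')
  · exact Or.inr hx

/-- The region of `h` collects the largest expected total gain at level `h`, since it contains
exactly the points with positive gain, apart from the origin, which no region can avoid. -/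
theorem IsHopCost.visitSum_gain_le (hd : IsHopCost d) (hp1 : p ≤ 1) (hq0 : 0 ≤ q) (hq1 : q ≤ 1)
    (lam h h' : ℝ) :
    visitSum p q (contSet d p q lam h') (gain d p q lam h) ≤
      visitSum p q (contSet d p q lam h) (gain d p q lam h) := by
  classical
  refine Summable.tsum_le_tsum (fun x => ?_)
    (summable_mul_of_finite_support ((hd.isRegion_contSet hq0 hq1 p lam h').finite_support p) _)
    (summable_mul_of_finite_support ((hd.isRegion_contSet hq0 hq1 p lam h).finite_support p) _)
  have hv := visit_nonneg hp1 hq0 hq1 x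
  simp only [Set.indicator_apply]
  split_ifs with h1 h2 h2
  · exact le_rfl
  · simpa using mul_nonpos_of_nonneg_of_nonpos hv (gain_nonpos_of_notMem h2)
  · have hx0 : x ≠ (0, 0) := fun h => h1 (h ▸ zero_mem_contSet d p q lam h')
    simpa using mul_nonneg hv (gain_pos_of_mem h2 hx0).le
  · exact le_rfl

theorem IsHopCost.g_eq (hd : IsHopCost d) (hp0 : 0 < p) (hp1 : p ≤ 1) (hq0 : 0 ≤ q)
    (hq1 : q ≤ 1) (lam h a : ℝ) :
    p * visitSum p q (contSet d p q lam h) (fun _ => 1) * (g d p q lam h - a) =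
      lam + d 0 - visitSum p q (contSet d p q lam h) (gain d p q lam a) :=
  (hd.isRegion_contSet hq0 hq1 p lam h).renewalCost_eq (zero_mem_contSet d p q lam h)
    hp0 hp1 hq0 hq1 d lam a

theorem IsHopCost.factor_pos (hd : IsHopCost d) (hp0 : 0 < p) (hp1 : p ≤ 1) (hq0 : 0 ≤ q)
    (hq1 : q ≤ 1) (lam h : ℝ) : 0 < p * visitSum p q (contSet d p q lam h) fun _ => 1 :=
  mul_pos hp0 (visitSum_one_pos hp1 hq0 hq1 (hd.isRegion_contSet hq0 hq1 p lam h)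
    (zero_mem_contSet d p q lam h))

/-- A fixed point of `g` bounds all renewal costs from below. -/
theorem IsHopCost.le_g_of_fixed (hd : IsHopCost d) (hp0 : 0 < p) (hp1 : p ≤ 1) (hq0 : 0 ≤ q)
    (hq1 : q ≤ 1) {h : ℝ} (hfix : g d p q lam h = h) (h' : ℝ) : h ≤ g d p q lam h' := by
  have e1 := hd.g_eq hp0 hp1 hq0 hq1 lam h h
  have e2 := hd.g_eq hp0 hp1 hq0 hq1 lam h' h
  have e3 := hd.visitSum_gain_le hp1 hq0 hq1 lam h h'
  rw [hfix, sub_self, mul_zero] at e1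
  have : 0 ≤ g d p q lam h' - h :=
    nonneg_of_mul_nonneg_right (by rw [e2]; linarith) (hd.factor_pos hp0 hp1 hq0 hq1 lam h')
  linarith

/-- From the first pass on, the iterates do not increase: the rule of `g h` is optimal at
level `g h`, where the rule of `h` balances. -/
theorem IsHopCost.g_g_le (hd : IsHopCost d) (hp0 : 0 < p) (hp1 : p ≤ 1) (hq0 : 0 ≤ q)
    (hq1 : q ≤ 1) (h : ℝ) : g d p q lam (g d p q lam h) ≤ g d p q lam h := by
  set h' := g d p q lam h with hh'
  have e1 := hd.g_eq hp0 hp1 hq0 hq1 lam h h'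
  have e2 := hd.g_eq hp0 hp1 hq0 hq1 lam h' h'
  have e3 := hd.visitSum_gain_le hp1 hq0 hq1 lam h' h
  rw [← hh', sub_self, mul_zero] at e1
  by_contra hcon
  have := mul_pos (hd.factor_pos hp0 hp1 hq0 hq1 lam h') (sub_pos.2 (not_le.1 hcon))
  linarith

theorem IsHopCost.g_nonneg (hd : IsHopCost d) (hp0 : 0 < p) (hp1 : p ≤ 1) (hq0 : 0 ≤ q)
    (hq1 : q ≤ 1) (hlam : 0 ≤ lam) (h : ℝ) : 0 ≤ g d p q lam h := by
  have hC := hd.isRegion_contSet hq0 hq1 p lam h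
  have e1 := hd.g_eq hp0 hp1 hq0 hq1 lam h 0
  have e2 := hC.visitSum_mono hp1 hq0 hq1 (φ := gain d p q lam 0) (ψ := fun _ => p * lam)
    fun x => by simpa [gain] using hd.deltaq_nonneg hq0 hq1 x.1 x.2
  have e3 := mul_le_mul_of_nonneg_left
    (hC.mul_visitSum_one_le hp1 hq0 hq1 (zero_mem_contSet d p q lam h)) hlam
  rw [visitSum_const] at e2
  rw [sub_zero] at e1
  have := hd.pos_zero
  exact nonneg_of_mul_nonneg_right (by rw [e1]; linarith) (hd.factor_pos hp0 hp1 hq0 hq1 lam h)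

/-- Below a given level there are only finitely many renewal costs, because `g h` depends only on
the points of the region that the path can visit. -/
theorem IsHopCost.finite_image_g (hd : IsHopCost d) (hp0 : 0 < p) (hp1 : p ≤ 1) (hq0 : 0 ≤ q)
    (hq1 : q ≤ 1) (lam H : ℝ) : (g d p q lam '' Set.Iic H).Finite := by
  classical
  set D := ((hd.isRegion_contSet hq0 hq1 p lam H).finite_support p).toFinset with hD
  let Φ : Finset (ℕ × ℕ) → ℝ := fun E =>
    (lam + d 0 - ∑ x ∈ E, visit p q x * gain d p q lam 0 x) / (p * ∑ x ∈ E, visit p q x * 1)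
  refine (D.powerset.image Φ).finite_toSet.subset ?_
  rintro _ ⟨h, hh, rfl⟩
  rw [Finset.mem_coe, Finset.mem_image]
  have hsum : ∀ φ, visitSum p q (contSet d p q lam h) φ =
      ∑ x ∈ D with x ∈ contSet d p q lam h, visit p q x * φ x := by
    intro φ
    rw [visitSum, Finset.sum_filter, tsum_eq_sum (s := D)]
    · refine Finset.sum_congr rfl fun x _ => ?_
      rw [Set.indicator_apply]
      split_ifs <;> simp
    · intro x hx
      rw [hD, Set.Finite.mem_toFinset, Function.mem_support, not_not] at hx
      by_cases hxh : x ∈ contSet d p q lam h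
      · rw [Set.indicator_of_mem (contSet_mono hp0.le hh hxh)] at hx
        rw [Set.indicator_of_mem hxh, hx, zero_mul]
      · rw [Set.indicator_of_notMem hxh, zero_mul]
  refine ⟨_, Finset.mem_powerset.2 (Finset.filter_subset (· ∈ contSet d p q lam h) D), ?_⟩
  have e := hd.g_eq hp0 hp1 hq0 hq1 lam h 0
  have hpos := hd.factor_pos hp0 hp1 hq0 hq1 lam h
  rw [sub_zero] at e
  simp only [Φ, ← hsum]
  rw [← e, mul_div_cancel_left₀ _ hpos.ne']

theorem oslaLoop_of_iterate_fixed (d : ℝ → ℝ) (p q lam : ℝ) (k : ℕ) (h : ℝ)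
    (hk : g d p q lam ((g d p q lam)^[k] h) = (g d p q lam)^[k] h) :
    ∃ (N j : ℕ), g d p q lam ((g d p q lam)^[j] h) = (g d p q lam)^[j] h ∧
      oslaLoop d p q lam N h =
        some ((g d p q lam)^[j] h, placementSet d p q lam ((g d p q lam)^[j] h)) := by
  induction k generalizing h with
  | zero =>
    have hk : g d p q lam h = h := hk
    exact ⟨1, 0, hk, by simp [oslaLoop, hk]⟩
  | succ k ih =>
    -- the loop may stop before the `k`-th iterate
    by_cases hh : g d p q lam h = h
    · exact ⟨1, 0, hh, by simp [oslaLoop, hh]⟩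
    · obtain ⟨N, j, hj, hN⟩ := ih (g d p q lam h) hk
      exact ⟨N + 1, j + 1, hj, by simpa [oslaLoop, hh] using hN⟩

/-- The loop terminates and returns a fixed point of `g`: the iterates decrease within a finite
set. -/
theorem IsHopCost.exists_oslaLoop_eq (hd : IsHopCost d) (hp0 : 0 < p) (hp1 : p ≤ 1)
    (hq0 : 0 ≤ q) (hq1 : q ≤ 1) (hlam : 0 ≤ lam) :
    ∃ (N : ℕ) (h : ℝ), 0 ≤ h ∧ g d p q lam h = h ∧
      oslaLoop d p q lam N 0 = some (h, placementSet d p q lam h) := by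
  set G := g d p q lam with hG
  have hstep : ∀ k, G^[k + 2] 0 ≤ G^[k + 1] 0 := fun k => by
    rw [Function.iterate_succ_apply', Function.iterate_succ_apply']
    exact hd.g_g_le hp0 hp1 hq0 hq1 _
  have hanti : Antitone fun k => G^[k + 1] 0 := antitone_nat_of_succ_le hstep
  have hfin : (Set.range fun k => G^[k + 2] 0).Finite := by
    refine (hd.finite_image_g hp0 hp1 hq0 hq1 lam (G^[1] 0)).subset ?_
    rintro _ ⟨k, rfl⟩
    exact ⟨G^[k + 1] 0, hanti (Nat.zero_le k), (Function.iterate_succ_apply' G (k + 1) 0).symm⟩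
  have hninj : ¬ Function.Injective fun k => G^[k + 2] 0 := fun hinj =>
    Set.infinite_range_of_injective hinj hfin
  obtain ⟨i, j, hij, hlt⟩ : ∃ i j, G^[i + 2] 0 = G^[j + 2] 0 ∧ i < j := by
    simp only [Function.Injective, not_forall] at hninj
    obtain ⟨i, j, hij, hne⟩ := hninj
    rcases lt_or_gt_of_ne hne with hlt | hlt
    · exact ⟨i, j, hij, hlt⟩
    · exact ⟨j, i, hij.symm, hlt⟩
  have hfix : G (G^[i + 2] 0) = G^[i + 2] 0 := by
    rw [← Function.iterate_succ_apply' G]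
    refine le_antisymm (hstep (i + 1)) ?_
    rw [hij]
    exact hanti (show i + 2 ≤ j + 1 by omega)
  obtain ⟨N, j, hj, hN⟩ := oslaLoop_of_iterate_fixed d p q lam (i + 2) 0 hfix
  refine ⟨N, _, ?_, hj, hN⟩
  rw [← hj]
  exact hd.g_nonneg hp0 hp1 hq0 hq1 hlam _

end

/-! ### The value function at a fixed point -/

section

variable {d : ℝ → ℝ} {p q lam h : ℝ}

/-- The expected total positive gain collected by a path that starts at `x`. -/
def totalGain (d : ℝ → ℝ) (p q lam h : ℝ) (x : ℕ × ℕ) : ℝ :=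
  ∑' y, visit p q y * max 0 (gain d p q lam h (x + y))

/-- The candidate for the optimal cost-to-go from the state `(x, c)` when the cost of each renewal
is `h`: the cost of placing at once, reduced by the gains from postponing. -/
def value (d : ℝ → ℝ) (p q lam h : ℝ) (x : ℕ × ℕ) : ℝ :=
  lam + hop d x.1 x.2 + h - totalGain d p q lam h x

/-- The expected cost of making one step from `x` without placing, with `value` as the cost-to-go
if the path continues. -/
def valueNotPlace (d : ℝ → ℝ) (p q lam h : ℝ) (x : ℕ × ℕ) : ℝ :=
  p * stepMean q (fun y => hop d y.1 y.2) x + (1 - p) * stepMean q (value d p q lam h) x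

theorem IsRegion.translate {C : Set (ℕ × ℕ)} (hC : IsRegion q C) (x : ℕ × ℕ) :
    IsRegion q {y | x + y ∈ C} := by
  refine ⟨fun y z hzy hy => hC.lower (add_le_add_right hzy x) hy, ?_⟩
  obtain ⟨M, hM⟩ := hC.bdd
  refine ⟨M, fun y hy => ⟨fun hq => ?_, fun hq => ?_⟩⟩
  · exact le_trans (by simp) ((hM _ hy).1 hq)
  · exact le_trans (by simp) ((hM _ hy).2 hq)

theorem visitSum_eq_tsum {C : Set (ℕ × ℕ)} {φ : ℕ × ℕ → ℝ} (hφ : ∀ x ∉ C, φ x = 0) :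
    visitSum p q C φ = ∑' x, visit p q x * φ x := by
  refine tsum_congr fun x => ?_
  by_cases hx : x ∈ C
  · rw [Set.indicator_of_mem hx]
  · rw [hφ x hx, mul_zero, mul_zero]

theorem max_gain_eq_zero {x : ℕ × ℕ} (hx : x ∉ contSet d p q lam h) :
    max 0 (gain d p q lam h x) = 0 :=
  max_eq_left (gain_nonpos_of_notMem hx)

theorem totalGain_eq_visitSum (x : ℕ × ℕ) :
    totalGain d p q lam h x =
      visitSum p q {y | x + y ∈ contSet d p q lam h} fun y => max 0 (gain d p q lam h (x + y)) :=
  (visitSum_eq_tsum (φ := fun y => max 0 (gain d p q lam h (x + y)))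
    fun _ hy => max_gain_eq_zero hy).symm

theorem IsHopCost.totalGain_eq (hd : IsHopCost d) (hq0 : 0 ≤ q) (hq1 : q ≤ 1) (p lam h : ℝ)
    (x : ℕ × ℕ) :
    totalGain d p q lam h x =
      max 0 (gain d p q lam h x) + (1 - p) * stepMean q (totalGain d p q lam h) x := by
  have hC := (hd.isRegion_contSet hq0 hq1 p lam h).translate x
  have hfs := hC.finite_support p
  have e1 : ∀ y : ℕ × ℕ, x + (y.1 + 1, y.2) = (x.1 + 1, x.2) + y := fun y => by
    ext <;> simp; omega
  have e2 : ∀ y : ℕ × ℕ, x + (y.1, y.2 + 1) = (x.1, x.2 + 1) + y := fun y => by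
    ext <;> simp; omega
  have hvan : ∀ z : ℕ × ℕ, x ≤ z → ∀ y ∉ {y | x + y ∈ contSet d p q lam h},
      max 0 (gain d p q lam h (z + y)) = 0 := by
    intro z hz y hy
    refine max_eq_left ?_
    exact (hd.gain_anti hq0 hq1 p lam h (add_le_add_left hz y)).trans (gain_nonpos_of_notMem hy)
  have hle1 : x ≤ (x.1 + 1, x.2) := ⟨by simp, le_rfl⟩
  have hle2 : x ≤ (x.1, x.2 + 1) := ⟨le_rfl, by simp⟩
  rw [totalGain_eq_visitSum, hC.visitSum_eq p fun _ hy => max_gain_eq_zero hy]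
  congr 2
  simp only [stepMean, totalGain]
  rw [← visitSum_eq_tsum (hvan _ hle1), ← visitSum_eq_tsum (hvan _ hle2)]
  simp only [visitSum]
  rw [← tsum_mul_left, ← tsum_mul_left,
    ← ((summable_mul_of_finite_support hfs _).mul_left q).tsum_add
      ((summable_mul_of_finite_support hfs _).mul_left (1 - q))]
  refine tsum_congr fun y => ?_
  rw [stepMean, e1, e2]
  ring

theorem totalGain_nonneg (hp1 : p ≤ 1) (hq0 : 0 ≤ q) (hq1 : q ≤ 1) (x : ℕ × ℕ) :
    0 ≤ totalGain d p q lam h x :=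
  tsum_nonneg fun y => mul_nonneg (visit_nonneg hp1 hq0 hq1 y) (le_max_left _ _)

theorem IsHopCost.totalGain_eq_zero (hd : IsHopCost d) (hq0 : 0 ≤ q) (hq1 : q ≤ 1) {x z : ℕ × ℕ}
    (hx : gain d p q lam h x ≤ 0) (hxz : x ≤ z) : totalGain d p q lam h z = 0 := by
  have : ∀ y, max 0 (gain d p q lam h (z + y)) = 0 := fun y => by
    refine max_eq_left ((hd.gain_anti hq0 hq1 p lam h ?_).trans hx)
    exact hxz.trans (by simp)
  simp [totalGain, this]

/-- All possible gains are at most `p * (lam + h)` per step, and the path makes `1 / p` steps on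
average. -/
theorem IsHopCost.totalGain_le (hd : IsHopCost d) (hp0 : 0 < p) (hp1 : p ≤ 1) (hq0 : 0 ≤ q)
    (hq1 : q ≤ 1) (hlh : 0 ≤ lam + h) (x : ℕ × ℕ) : totalGain d p q lam h x ≤ lam + h := by
  by_cases hx : x ∈ contSet d p q lam h
  · have hC := (hd.isRegion_contSet hq0 hq1 p lam h).translate x
    rw [totalGain_eq_visitSum]
    have e1 := hC.visitSum_mono (p := p) hp1 hq0 hq1
      (φ := fun y => max 0 (gain d p q lam h (x + y))) (ψ := fun _ => p * (lam + h)) fun y =>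
        max_le (by positivity) (sub_le_self _ (hd.deltaq_nonneg hq0 hq1 _ _))
    rw [visitSum_const] at e1
    have e2 := mul_le_mul_of_nonneg_left
      (hC.mul_visitSum_one_le (p := p) hp1 hq0 hq1 (show x + (0, 0) ∈ _ from hx)) hlh
    linarith
  · rwa [hd.totalGain_eq_zero hq0 hq1 (gain_nonpos_of_notMem hx) le_rfl]

/-- At a fixed point of `g` it is not optimal to place a relay next to the previous one. -/
theorem IsHopCost.gain_zero_pos (hd : IsHopCost d) (hp0 : 0 < p) (hp1 : p ≤ 1) (hq0 : 0 ≤ q)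
    (hq1 : q ≤ 1) (hlam : 0 ≤ lam) (hfix : g d p q lam h = h) :
    0 < gain d p q lam h (0, 0) := by
  by_contra hcon
  have e := hd.g_eq hp0 hp1 hq0 hq1 lam h h
  have hle := (hd.isRegion_contSet hq0 hq1 p lam h).visitSum_mono (p := p) hp1 hq0 hq1
    (φ := gain d p q lam h) (ψ := fun _ => 0)
    fun x => (hd.gain_anti hq0 hq1 p lam h (Prod.mk_le_mk.2 ⟨Nat.zero_le _, Nat.zero_le _⟩)).trans
      (not_lt.1 hcon)
  rw [visitSum_const, zero_mul] at hle
  rw [hfix, sub_self, mul_zero] at e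
  have := hd.pos_zero
  linarith

theorem IsHopCost.totalGain_zero (hd : IsHopCost d) (hp0 : 0 < p) (hp1 : p ≤ 1) (hq0 : 0 ≤ q)
    (hq1 : q ≤ 1) (hlam : 0 ≤ lam) (hfix : g d p q lam h = h) :
    totalGain d p q lam h (0, 0) = lam + d 0 := by
  have e := hd.g_eq hp0 hp1 hq0 hq1 lam h h
  rw [hfix, sub_self, mul_zero] at e
  rw [eq_comm, sub_eq_zero] at e
  rw [e, totalGain, visitSum]
  refine tsum_congr fun y => ?_
  rw [show ((0, 0) : ℕ × ℕ) + y = y by ext <;> simp]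
  by_cases hy : y ∈ contSet d p q lam h
  · rw [Set.indicator_of_mem hy]
    by_cases hy0 : y = (0, 0)
    · rw [hy0, max_eq_right (hd.gain_zero_pos hp0 hp1 hq0 hq1 hlam hfix).le]
    · rw [max_eq_right (gain_pos_of_mem hy hy0).le]
  · rw [Set.indicator_of_notMem hy, max_gain_eq_zero hy, mul_zero, zero_mul]

theorem valueNotPlace_eq (x : ℕ × ℕ) :
    valueNotPlace d p q lam h x = lam + hop d x.1 x.2 + h - gain d p q lam h x -
      (1 - p) * stepMean q (totalGain d p q lam h) x := by
  simp only [valueNotPlace, stepMean, value, gain, deltaq, delta1, delta2, Nat.cast_add,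
    Nat.cast_one]
  ring

theorem stepMean_nonneg (hq0 : 0 ≤ q) (hq1 : q ≤ 1) {φ : ℕ × ℕ → ℝ} (hφ : ∀ y, 0 ≤ φ y)
    (x : ℕ × ℕ) : 0 ≤ stepMean q φ x :=
  add_nonneg (mul_nonneg hq0 (hφ _)) (mul_nonneg (sub_nonneg.2 hq1) (hφ _))

theorem IsHopCost.value_le_valueNotPlace (hd : IsHopCost d) (hq0 : 0 ≤ q) (hq1 : q ≤ 1)
    (x : ℕ × ℕ) : value d p q lam h x ≤ valueNotPlace d p q lam h x := by
  rw [valueNotPlace_eq, value, hd.totalGain_eq hq0 hq1]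
  have := le_max_right 0 (gain d p q lam h x)
  linarith

theorem value_le_place (hp1 : p ≤ 1) (hq0 : 0 ≤ q) (hq1 : q ≤ 1) (x : ℕ × ℕ) :
    value d p q lam h x ≤ lam + hop d x.1 x.2 + h :=
  sub_le_self _ (totalGain_nonneg hp1 hq0 hq1 x)

theorem IsHopCost.value_eq_of_mem (hd : IsHopCost d) (hq0 : 0 ≤ q) (hq1 : q ≤ 1) {x : ℕ × ℕ}
    (hx : x ∈ placementSet d p q lam h) :
    value d p q lam h x = lam + hop d x.1 x.2 + h := by
  rw [value, hd.totalGain_eq_zero hq0 hq1 (mem_placementSet_iff.1 hx) le_rfl, sub_zero]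

theorem IsHopCost.value_eq_of_notMem (hd : IsHopCost d) (hq0 : 0 ≤ q) (hq1 : q ≤ 1) {x : ℕ × ℕ}
    (hx : x ∉ placementSet d p q lam h) :
    value d p q lam h x = valueNotPlace d p q lam h x := by
  rw [mem_placementSet_iff, not_le] at hx
  rw [valueNotPlace_eq, value, hd.totalGain_eq hq0 hq1, max_eq_right hx.le]
  ring

/-- The one-step-look-ahead comparison decides optimally, because the placement set is closed
under steps. -/
theorem IsHopCost.place_le_valueNotPlace_iff (hd : IsHopCost d) (hp1 : p ≤ 1) (hq0 : 0 ≤ q)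
    (hq1 : q ≤ 1) {x : ℕ × ℕ} :
    lam + hop d x.1 x.2 + h ≤ valueNotPlace d p q lam h x ↔ x ∈ placementSet d p q lam h := by
  rw [valueNotPlace_eq, mem_placementSet_iff]
  have hG := mul_nonneg (sub_nonneg.2 hp1)
    (stepMean_nonneg hq0 hq1 (totalGain_nonneg (d := d) (lam := lam) (h := h) hp1 hq0 hq1) x)
  constructor
  · intro hle
    linarith
  · intro hx
    have : stepMean q (totalGain d p q lam h) x = 0 := by
      rw [stepMean, hd.totalGain_eq_zero hq0 hq1 hx (z := (x.1 + 1, x.2)) ⟨by simp, le_rfl⟩,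
        hd.totalGain_eq_zero hq0 hq1 hx (z := (x.1, x.2 + 1)) ⟨le_rfl, by simp⟩]
      ring
    rw [this]
    linarith

theorem IsHopCost.value_nonneg (hd : IsHopCost d) (hp0 : 0 < p) (hp1 : p ≤ 1) (hq0 : 0 ≤ q)
    (hq1 : q ≤ 1) (hlh : 0 ≤ lam + h) (x : ℕ × ℕ) : 0 ≤ value d p q lam h x := by
  have h1 := hd.totalGain_le hp0 hp1 hq0 hq1 hlh x
  have h2 := hd.hop_pos x.1 x.2
  rw [value]
  linarith

theorem IsHopCost.valueNotPlace_nonneg (hd : IsHopCost d) (hp0 : 0 < p) (hp1 : p ≤ 1)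
    (hq0 : 0 ≤ q) (hq1 : q ≤ 1) (hlh : 0 ≤ lam + h) (x : ℕ × ℕ) :
    0 ≤ valueNotPlace d p q lam h x :=
  (hd.value_nonneg hp0 hp1 hq0 hq1 hlh x).trans (hd.value_le_valueNotPlace hq0 hq1 x)

theorem IsHopCost.value_zero (hd : IsHopCost d) (hp0 : 0 < p) (hp1 : p ≤ 1) (hq0 : 0 ≤ q)
    (hq1 : q ≤ 1) (hlam : 0 ≤ lam) (hfix : g d p q lam h = h) :
    value d p q lam h (0, 0) = h := by
  rw [value, hd.totalGain_zero hp0 hp1 hq0 hq1 hlam hfix]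
  simp [hop]

theorem IsHopCost.valueNotPlace_zero (hd : IsHopCost d) (hp0 : 0 < p) (hp1 : p ≤ 1) (hq0 : 0 ≤ q)
    (hq1 : q ≤ 1) (hlam : 0 ≤ lam) (hfix : g d p q lam h = h) :
    valueNotPlace d p q lam h (0, 0) = h := by
  rw [← hd.value_eq_of_notMem hq0 hq1, hd.value_zero hp0 hp1 hq0 hq1 hlam hfix]
  rw [mem_placementSet_iff, not_le]
  exact hd.gain_zero_pos hp0 hp1 hq0 hq1 hlam hfix

/-- The expected cost-to-go after a step is dominated by the expected cost at the end of the path,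
since the path ends with probability `p` at each step, at the same distribution of positions. -/
theorem IsHopCost.valueNotPlace_le (hd : IsHopCost d) (hp0 : 0 < p) (hp1 : p ≤ 1) (hq0 : 0 ≤ q)
    (hq1 : q ≤ 1) (hlh : 0 ≤ lam + h) (x : ℕ × ℕ) :
    valueNotPlace d p q lam h x ≤
      (1 + (lam + h) / d 0) / p * (p * stepMean q (fun y => hop d y.1 y.2) x) := by
  set H := stepMean q (fun y => hop d y.1 y.2) x with hH
  have hd0 := hd.pos_zero
  have hHd : d 0 ≤ H := by
    have h1 := mul_le_mul_of_nonneg_left (hd.le_hop ((x.1 + 1 : ℕ) : ℝ) x.2) hq0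
    have h2 := mul_le_mul_of_nonneg_left (hd.le_hop x.1 ((x.2 + 1 : ℕ) : ℝ)) (sub_nonneg.2 hq1)
    rw [hH, stepMean]
    linarith
  have hW : stepMean q (value d p q lam h) x ≤ lam + h + H := by
    have h1 := mul_le_mul_of_nonneg_left
      (value_le_place (d := d) (lam := lam) (h := h) hp1 hq0 hq1 (x.1 + 1, x.2)) hq0
    have h2 := mul_le_mul_of_nonneg_left
      (value_le_place (d := d) (lam := lam) (h := h) hp1 hq0 hq1 (x.1, x.2 + 1)) (sub_nonneg.2 hq1)
    rw [hH, stepMean, stepMean]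
    simp only at h1 h2 ⊢
    linarith
  have e1 : valueNotPlace d p q lam h x ≤ H + (lam + h) := by
    have h1 := mul_le_mul_of_nonneg_left hW (sub_nonneg.2 hp1)
    have h2 := mul_nonneg hp0.le hlh
    rw [valueNotPlace, ← hH]
    linarith
  have e2 : lam + h ≤ (lam + h) / d 0 * H := by
    rw [div_mul_eq_mul_div, le_div_iff₀ hd0]
    exact mul_le_mul_of_nonneg_left hHd hlh
  have e3 : (1 + (lam + h) / d 0) / p * (p * H) = H + (lam + h) / d 0 * H := by
    field_simp
  linarith

end

/-! ### Expectations of nonnegative functions under discrete laws -/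

/-- The expectation of an `ℝ≥0∞`-valued function under a discrete law. -/
def expect {α : Type} (μ : PMF α) (F : α → ℝ≥0∞) : ℝ≥0∞ := ∑' x, μ x * F x

theorem expect_pure {α : Type} (a : α) (F : α → ℝ≥0∞) : expect (PMF.pure a) F = F a := by
  classical
  rw [expect, tsum_eq_single a]
  · simp
  · intro b hb
    simp [PMF.pure_apply, hb]

theorem expect_bind {α β : Type} (μ : PMF α) (κ : α → PMF β) (F : β → ℝ≥0∞) :
    expect (μ.bind κ) F = expect μ fun x => expect (κ x) F := by
  simp only [expect, PMF.bind_apply, ← ENNReal.tsum_mul_right, ← ENNReal.tsum_mul_left]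
  rw [ENNReal.tsum_comm]
  exact tsum_congr fun x => tsum_congr fun y => mul_assoc _ _ _

theorem expect_map {α β : Type} (μ : PMF α) (f : α → β) (F : β → ℝ≥0∞) :
    expect (μ.map f) F = expect μ fun x => F (f x) := by
  rw [PMF.map, expect_bind]
  simp only [Function.comp_apply, expect_pure]

theorem expect_add {α : Type} (μ : PMF α) (F G : α → ℝ≥0∞) :
    expect μ (fun x => F x + G x) = expect μ F + expect μ G := by
  simp only [expect, mul_add]
  exact ENNReal.tsum_add

theorem expect_mono {α : Type} (μ : PMF α) {F G : α → ℝ≥0∞} (h : ∀ x, F x ≤ G x) :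
    expect μ F ≤ expect μ G :=
  ENNReal.tsum_le_tsum fun x => mul_le_mul_right (h x) _

theorem expect_const {α : Type} (μ : PMF α) (c : ℝ≥0∞) : expect μ (fun _ => c) = c := by
  rw [expect, ENNReal.tsum_mul_right, μ.tsum_coe, one_mul]

theorem expect_const_mul {α : Type} (μ : PMF α) (c : ℝ≥0∞) (F : α → ℝ≥0∞) :
    expect μ (fun x => c * F x) = c * expect μ F := by
  simp only [expect, ← ENNReal.tsum_mul_left]
  exact tsum_congr fun x => by ring

theorem expect_coin (a : unitInterval) (F : Bool → ℝ≥0∞) :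
    expect (coin a) F =
      ENNReal.ofReal a * F true + ENNReal.ofReal (1 - (a : ℝ)) * F false := by
  simp [expect, coin, PMF.ofFintype_apply]

theorem expect_move (p q : unitInterval) (m n : ℕ) (F : State → ℝ≥0∞) :
    expect (move p q m n) F =
      ENNReal.ofReal q * (ENNReal.ofReal p * F (State.ended (m + 1) n) +
        ENNReal.ofReal (1 - (p : ℝ)) * F (State.run (m + 1) n)) +
      ENNReal.ofReal (1 - (q : ℝ)) * (ENNReal.ofReal p * F (State.ended m (n + 1)) +
        ENNReal.ofReal (1 - (p : ℝ)) * F (State.run m (n + 1))) := by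
  simp only [move, expect_bind, expect_map, expect_coin]

/-- A step whose outcomes have real costs `a` (path ends) and `b` (path continues). -/
theorem expect_move_ofReal (p q : unitInterval) (m n : ℕ) {F : State → ℝ≥0∞} {a b : ℕ × ℕ → ℝ}
    (ha : ∀ x, 0 ≤ a x) (hb : ∀ x, 0 ≤ b x)
    (hFa : ∀ m n, F (State.ended m n) = ENNReal.ofReal (a (m, n)))
    (hFb : ∀ m n, F (State.run m n) = ENNReal.ofReal (b (m, n))) :
    expect (move p q m n) F =
      ENNReal.ofReal (p * stepMean q a (m, n) + (1 - p) * stepMean q b (m, n)) := by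
  have hp0 : (0 : ℝ) ≤ p := p.2.1
  have hp1 : (0 : ℝ) ≤ 1 - p := sub_nonneg.2 p.2.2
  have hq0 : (0 : ℝ) ≤ q := q.2.1
  have hq1 : (0 : ℝ) ≤ 1 - q := sub_nonneg.2 q.2.2
  have hsum : ∀ x : ℕ × ℕ, 0 ≤ (p : ℝ) * a x + (1 - p) * b x := fun x =>
    add_nonneg (mul_nonneg hp0 (ha x)) (mul_nonneg hp1 (hb x))
  simp only [expect_move, hFa, hFb]
  simp only [← ENNReal.ofReal_mul hp0, ← ENNReal.ofReal_mul hp1]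
  rw [← ENNReal.ofReal_add (mul_nonneg hp0 (ha _)) (mul_nonneg hp1 (hb _)),
    ← ENNReal.ofReal_add (mul_nonneg hp0 (ha _)) (mul_nonneg hp1 (hb _)),
    ← ENNReal.ofReal_mul hq0, ← ENNReal.ofReal_mul hq1,
    ← ENNReal.ofReal_add (mul_nonneg hq0 (hsum _)) (mul_nonneg hq1 (hsum _))]
  congr 1
  simp only [stepMean]
  ring

/-! ### Verification of the value function -/

section

variable (d : ℝ → ℝ) (p q : unitInterval) (lam h : ℝ)

/-- The expected cost of stage `k`. -/
def stageCost (π : Policy) (s : State) (k : ℕ) : ℝ≥0∞ :=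
  expect (law p q π s k) fun x => expect (π x.1 x.2) (stepCost d lam x.2)

/-- The value function on the states of the decision process. -/
def stateValue : State → ℝ≥0∞
  | State.run m n => ENNReal.ofReal (value d p q lam h (m, n))
  | State.ended m n => ENNReal.ofReal (hop d m n)
  | State.done => 0

/-- The cost that is incurred in a state if the path has ended there. -/
def endCost : State → ℝ≥0∞
  | State.run _ _ => 0
  | State.ended m n => ENNReal.ofReal (hop d m n)
  | State.done => 0

open Classical in
/-- The action of the one-step-look-ahead rule. -/
def lookAhead : State → Bool
  | State.run m n => decide ((m, n) ∈ placementSet d p q lam h)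
  | _ => true

theorem policyCost_eq (π : Policy) (s : State) :
    policyCost d p q lam π s = ∑' k, stageCost d p q lam π s k := by
  simp only [policyCost, stageCost, expect, tsum_fintype]

theorem expect_law_succ (π : Policy) (s : State) (k : ℕ) (F : State → ℝ≥0∞) :
    expect (law p q π s (k + 1)) (fun x => F x.2) =
      expect (law p q π s k) fun x =>
        expect (π x.1 x.2) fun u => expect (trans p q x.2 u) F := by
  simp only [law, expect_bind, expect_map]

variable {d p q lam h}

theorem IsHopCost.expect_move_stateValue (hd : IsHopCost d) (hp0 : 0 < p) (hlh : 0 ≤ lam + h)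
    (m n : ℕ) :
    expect (move p q m n) (stateValue d p q lam h) =
      ENNReal.ofReal (valueNotPlace d p q lam h (m, n)) :=
  expect_move_ofReal p q m n (a := fun x => hop d x.1 x.2) (fun x => (hd.hop_pos x.1 x.2).le)
    (hd.value_nonneg hp0 p.2.2 q.2.1 q.2.2 hlh) (fun _ _ => rfl) fun _ _ => rfl

theorem IsHopCost.expect_move_endCost (hd : IsHopCost d) (m n : ℕ) :
    expect (move p q m n) (endCost d) =
      ENNReal.ofReal (p * stepMean q (fun x => hop d x.1 x.2) (m, n)) := by
  rw [expect_move_ofReal p q m n (a := fun x => hop d x.1 x.2) (b := fun _ => 0)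
    (fun x => (hd.hop_pos x.1 x.2).le) (fun _ => le_rfl) (fun _ _ => rfl) fun _ _ => by
      simp [endCost]]
  simp [stepMean]

theorem IsHopCost.stepCost_place_add (hd : IsHopCost d) (hp0 : 0 < p) (hlam : 0 ≤ lam)
    (hh : 0 ≤ h) (hfix : g d p q lam h = h) (m n : ℕ) :
    stepCost d lam (State.run m n) true +
        expect (trans p q (State.run m n) true) (stateValue d p q lam h) =
      ENNReal.ofReal (lam + hop d m n + h) := by
  have := (hd.hop_pos m n).le
  rw [stepCost, trans, hd.expect_move_stateValue hp0 (add_nonneg hlam hh),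
    hd.valueNotPlace_zero hp0 p.2.2 q.2.1 q.2.2 hlam hfix, ← ENNReal.ofReal_add (by positivity) hh]

theorem IsHopCost.stateValue_le (hd : IsHopCost d) (hp0 : 0 < p) (hlam : 0 ≤ lam)
    (hh : 0 ≤ h) (hfix : g d p q lam h = h) (s : State) (u : Bool) :
    stateValue d p q lam h s ≤
      stepCost d lam s u + expect (trans p q s u) (stateValue d p q lam h) := by
  rcases s with ⟨m, n⟩ | ⟨m, n⟩ | _
  · cases u
    · rw [stepCost, trans, hd.expect_move_stateValue hp0 (add_nonneg hlam hh), zero_add]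
      exact ENNReal.ofReal_le_ofReal (hd.value_le_valueNotPlace q.2.1 q.2.2 _)
    · rw [hd.stepCost_place_add hp0 hlam hh hfix]
      exact ENNReal.ofReal_le_ofReal (value_le_place p.2.2 q.2.1 q.2.2 _)
  · exact le_self_add
  · exact zero_le

theorem IsHopCost.stateValue_eq (hd : IsHopCost d) (hp0 : 0 < p) (hlam : 0 ≤ lam)
    (hh : 0 ≤ h) (hfix : g d p q lam h = h) (s : State) :
    stateValue d p q lam h s = stepCost d lam s (lookAhead d p q lam h s) +
      expect (trans p q s (lookAhead d p q lam h s)) (stateValue d p q lam h) := by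
  rcases s with ⟨m, n⟩ | ⟨m, n⟩ | _
  · by_cases hx : (m, n) ∈ placementSet d p q lam h
    · have : lookAhead d p q lam h (State.run m n) = true := by simp [lookAhead, hx]
      rw [this, hd.stepCost_place_add hp0 hlam hh hfix, stateValue,
        hd.value_eq_of_mem q.2.1 q.2.2 hx]
    · have : lookAhead d p q lam h (State.run m n) = false := by simp [lookAhead, hx]
      rw [this, stepCost, trans, hd.expect_move_stateValue hp0 (add_nonneg hlam hh), zero_add,
        stateValue, hd.value_eq_of_notMem q.2.1 q.2.2 hx]
  · simp [stateValue, stepCost, trans, expect_pure]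
  · simp [stateValue, stepCost, trans, expect_pure]

/-- The expected cost-to-go decreases during a stage by at most the expected cost of the stage. -/
theorem IsHopCost.expect_stateValue_le (hd : IsHopCost d) (hp0 : 0 < p) (hlam : 0 ≤ lam)
    (hh : 0 ≤ h) (hfix : g d p q lam h = h) (π : Policy) (s : State) (k : ℕ) :
    expect (law p q π s k) (fun x => stateValue d p q lam h x.2) ≤
      stageCost d p q lam π s k +
        expect (law p q π s (k + 1)) fun x => stateValue d p q lam h x.2 := by
  rw [expect_law_succ, stageCost, ← expect_add]
  refine expect_mono _ fun x => ?_
  rw [← expect_add, ← expect_const (π x.1 x.2) (stateValue d p q lam h x.2)]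
  exact expect_mono _ fun u => hd.stateValue_le hp0 hlam hh hfix x.2 u

theorem IsHopCost.stateValue_le_sum_add (hd : IsHopCost d) (hp0 : 0 < p) (hlam : 0 ≤ lam)
    (hh : 0 ≤ h) (hfix : g d p q lam h = h) (π : Policy) (s : State) (k : ℕ) :
    stateValue d p q lam h s ≤ ∑ i ∈ Finset.range k, stageCost d p q lam π s i +
      expect (law p q π s k) fun x => stateValue d p q lam h x.2 := by
  induction k with
  | zero => simp [law, expect_pure]
  | succ k ih =>
    refine ih.trans ?_
    rw [Finset.sum_range_succ, add_assoc]
    gcongr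
    exact hd.expect_stateValue_le hp0 hlam hh hfix π s k

theorem IsHopCost.expect_trans_stateValue_le (hd : IsHopCost d) (hp0 : 0 < p)
    (hlh : 0 ≤ lam + h) (s : State) (u : Bool) :
    expect (trans p q s u) (stateValue d p q lam h) ≤
      ENNReal.ofReal ((1 + (lam + h) / d 0) / p) * expect (trans p q s u) (endCost d) := by
  have hp0' : (0 : ℝ) < p := hp0
  have hK : 0 ≤ (1 + (lam + h) / d 0) / p := by
    have := hd.pos_zero
    positivity
  have hmove : ∀ m n, expect (move p q m n) (stateValue d p q lam h) ≤
      ENNReal.ofReal ((1 + (lam + h) / d 0) / p) * expect (move p q m n) (endCost d) := by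
    intro m n
    rw [hd.expect_move_stateValue hp0 hlh, hd.expect_move_endCost, ← ENNReal.ofReal_mul hK]
    exact ENNReal.ofReal_le_ofReal (hd.valueNotPlace_le hp0 p.2.2 q.2.1 q.2.2 hlh _)
  rcases s with ⟨m, n⟩ | ⟨m, n⟩ | _
  · cases u
    · exact hmove m n
    · exact hmove 0 0
  · simp [trans, expect_pure, stateValue]
  · simp [trans, expect_pure, stateValue]

/-- The expected cost-to-go after `k + 1` stages is dominated by the expected cost of stage
`k + 1`, so that it tends to zero along every policy of finite cost. This replaces any growth
condition on the one-hop cost. -/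
theorem IsHopCost.expect_law_stateValue_le (hd : IsHopCost d) (hp0 : 0 < p)
    (hlh : 0 ≤ lam + h) (π : Policy) (s : State) (k : ℕ) :
    expect (law p q π s (k + 1)) (fun x => stateValue d p q lam h x.2) ≤
      ENNReal.ofReal ((1 + (lam + h) / d 0) / p) * stageCost d p q lam π s (k + 1) := by
  have h1 : expect (law p q π s (k + 1)) (fun x => endCost d x.2) ≤
      stageCost d p q lam π s (k + 1) := by
    refine expect_mono _ fun x => ?_
    rw [← expect_const (π x.1 x.2) (endCost d x.2)]
    refine expect_mono _ fun u => ?_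
    rcases x.2 with ⟨m, n⟩ | ⟨m, n⟩ | _
    · exact zero_le
    · exact le_rfl
    · exact le_rfl
  refine le_trans ?_ (mul_le_mul_right h1 _)
  rw [expect_law_succ, expect_law_succ, ← expect_const_mul]
  refine expect_mono _ fun x => ?_
  rw [← expect_const_mul]
  exact expect_mono _ fun u => hd.expect_trans_stateValue_le hp0 hlh x.2 u

theorem IsHopCost.stateValue_le_policyCost (hd : IsHopCost d) (hp0 : 0 < p) (hlam : 0 ≤ lam)
    (hh : 0 ≤ h) (hfix : g d p q lam h = h) (π : Policy) (s : State) :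
    stateValue d p q lam h s ≤ policyCost d p q lam π s := by
  rw [policyCost_eq]
  by_cases htop : ∑' k, stageCost d p q lam π s k = ⊤
  · rw [htop]
    exact le_top
  have hz : Tendsto (stageCost d p q lam π s) atTop (𝓝 0) :=
    ENNReal.tendsto_atTop_zero_of_tsum_ne_top htop
  have hz' : Tendsto (fun k => ENNReal.ofReal ((1 + (lam + h) / d 0) / p) *
      stageCost d p q lam π s (k + 1)) atTop (𝓝 0) := by
    simpa using ENNReal.Tendsto.const_mul ((tendsto_add_atTop_iff_nat 1).2 hz)
      (Or.inr ENNReal.ofReal_ne_top)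
  have hlim := hz'.const_add (∑' k, stageCost d p q lam π s k)
  rw [add_zero] at hlim
  refine ge_of_tendsto' hlim fun k => ?_
  refine (hd.stateValue_le_sum_add hp0 hlam hh hfix π s (k + 1)).trans ?_
  exact add_le_add (ENNReal.sum_le_tsum _)
    (hd.expect_law_stateValue_le hp0 (add_nonneg hlam hh) π s k)

theorem IsHopCost.policyCost_lookAhead_le (hd : IsHopCost d) (hp0 : 0 < p) (hlam : 0 ≤ lam)
    (hh : 0 ≤ h) (hfix : g d p q lam h = h) (s : State) :
    policyCost d p q lam (fun _ s => PMF.pure (lookAhead d p q lam h s)) s ≤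
      stateValue d p q lam h s := by
  set π : Policy := fun _ s => PMF.pure (lookAhead d p q lam h s) with hπ
  have key : ∀ k, ∑ i ∈ Finset.range k, stageCost d p q lam π s i +
      expect (law p q π s k) (fun x => stateValue d p q lam h x.2) = stateValue d p q lam h s := by
    intro k
    induction k with
    | zero => simp [law, expect_pure]
    | succ k ih =>
      rw [← ih, Finset.sum_range_succ, add_assoc, expect_law_succ, stageCost, ← expect_add]
      congr 2
      funext x
      rw [hd.stateValue_eq hp0 hlam hh hfix x.2]
      simp only [hπ, expect_pure]
  rw [policyCost_eq]
  exact ENNReal.tsum_le_of_sum_range_le fun k => (key k) ▸ le_self_add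

theorem IsHopCost.optCost_eq (hd : IsHopCost d) (hp0 : 0 < p) (hlam : 0 ≤ lam)
    (hh : 0 ≤ h) (hfix : g d p q lam h = h) (m n : ℕ) :
    optCost d p q lam m n = ENNReal.ofReal (value d p q lam h (m, n)) :=
  le_antisymm
    ((iInf_le _ _).trans (hd.policyCost_lookAhead_le hp0 hlam hh hfix (State.run m n)))
    (le_iInf fun π => hd.stateValue_le_policyCost hp0 hlam hh hfix π (State.run m n))

theorem IsHopCost.costNotPlace_eq (hd : IsHopCost d) (hp0 : 0 < p) (hlam : 0 ≤ lam)
    (hh : 0 ≤ h) (hfix : g d p q lam h = h) (m n : ℕ) :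
    costNotPlace d p q lam m n = ENNReal.ofReal (valueNotPlace d p q lam h (m, n)) := by
  have hp0' : (0 : ℝ) ≤ p := p.2.1
  have hp1 : (0 : ℝ) ≤ 1 - p := sub_nonneg.2 p.2.2
  have hq0 : (0 : ℝ) ≤ q := q.2.1
  have hq1 : (0 : ℝ) ≤ 1 - q := sub_nonneg.2 q.2.2
  have hv : ∀ x, 0 ≤ value d p q lam h x :=
    hd.value_nonneg hp0 p.2.2 q.2.1 q.2.2 (add_nonneg hlam hh)
  have h1 := (hd.hop_pos ((m : ℝ) + 1) n).le
  have h2 := (hd.hop_pos m ((n : ℝ) + 1)).le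
  have h3 := hv (m + 1, n)
  have h4 := hv (m, n + 1)
  simp only [costNotPlace, hd.optCost_eq hp0 hlam hh hfix]
  rw [← ENNReal.ofReal_mul (by positivity), ← ENNReal.ofReal_mul (by positivity),
    ← ENNReal.ofReal_add (by positivity) (by positivity),
    ← ENNReal.ofReal_add (by positivity) (by positivity),
    ← ENNReal.ofReal_add (by positivity) (by positivity)]
  congr 1
  simp only [valueNotPlace, stepMean, Nat.cast_add, Nat.cast_one]
  ring

theorem IsHopCost.costPlace_eq (hd : IsHopCost d) (hp0 : 0 < p) (hlam : 0 ≤ lam)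
    (hh : 0 ≤ h) (hfix : g d p q lam h = h) (m n : ℕ) :
    costPlace d p q lam m n = ENNReal.ofReal (lam + hop d m n + h) := by
  have h0 := (hd.hop_pos m n).le
  have h1 : hop d (((0 : ℕ) : ℝ) + 1) ((0 : ℕ) : ℝ) = d 1 := by simp [hop]
  have h2 : hop d ((0 : ℕ) : ℝ) (((0 : ℕ) : ℝ) + 1) = d 1 := by simp [hop]
  have hd1 : 0 ≤ d 1 := h1 ▸ (hd.hop_pos _ _).le
  -- placing costs as much as stepping from the origin, where not placing is optimal
  have hsplit : costPlace d p q lam m n =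
      ENNReal.ofReal (lam + hop d m n) + costNotPlace d p q lam 0 0 := by
    have hp0' : (0 : ℝ) ≤ p := p.2.1
    have hq0 : (0 : ℝ) ≤ q := q.2.1
    have hq1 : (0 : ℝ) ≤ 1 - q := sub_nonneg.2 q.2.2
    have e : ENNReal.ofReal (p * d 1) =
        ENNReal.ofReal (p * q * d 1) + ENNReal.ofReal (p * (1 - q) * d 1) := by
      rw [← ENNReal.ofReal_add (by positivity) (by positivity)]
      congr 1
      ring
    rw [costPlace, costNotPlace, h1, h2, e]
    simp only [zero_add]
    ring
  rw [hsplit, hd.costNotPlace_eq hp0 hlam hh hfix,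
    hd.valueNotPlace_zero hp0 p.2.2 q.2.1 q.2.2 hlam hfix, ← ENNReal.ofReal_add (by positivity) hh]

theorem IsHopCost.optPlacementSet_eq (hd : IsHopCost d) (hp0 : 0 < p) (hlam : 0 ≤ lam)
    (hh : 0 ≤ h) (hfix : g d p q lam h = h) :
    optPlacementSet d p q lam = placementSet d p q lam h := by
  ext x
  rw [← hd.place_le_valueNotPlace_iff p.2.2 q.2.1 q.2.2, optPlacementSet, Set.mem_ofPred_eq,
    hd.costPlace_eq hp0 hlam hh hfix, hd.costNotPlace_eq hp0 hlam hh hfix]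
  exact ENNReal.ofReal_le_ofReal_iff
    (hd.valueNotPlace_nonneg hp0 p.2.2 q.2.1 q.2.2 (add_nonneg hlam hh) x)

end

end RelayPlacement

end

theorem mainTheorem3 (p q : unitInterval) (hp0 : 0 < p) (hp1 : p < 1)
    (lam : ℝ) (hlam : 0 ≤ lam) (d : ℝ → ℝ) (hd : RelayPlacement.IsHopCost d) :
    RelayPlacement.optCost d p q lam 0 0 ≠ ⊤ ∧
    IsLeast ((fun h : ℝ => RelayPlacement.g d p q lam h) '' Set.Ici 0)
      (RelayPlacement.gStar d p q lam) ∧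
    ∃ N : ℕ, RelayPlacement.oslaLoop d p q lam N 0 =
      some (RelayPlacement.gStar d p q lam, RelayPlacement.optPlacementSet d p q lam) := by
  obtain ⟨N, h, hh, hfix, hN⟩ := hd.exists_oslaLoop_eq (p := p) (q := q) hp0 p.2.2 q.2.1 q.2.2 hlam
  have hopt : RelayPlacement.optCost d p q lam 0 0 = ENNReal.ofReal h := by
    rw [hd.optCost_eq hp0 hlam hh hfix, hd.value_zero hp0 p.2.2 q.2.1 q.2.2 hlam hfix]
  have hg : RelayPlacement.gStar d p q lam = h := by
    rw [RelayPlacement.gStar, hopt, ENNReal.toReal_ofReal hh]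
  rw [hg, hd.optPlacementSet_eq hp0 hlam hh hfix]
  refine ⟨hopt ▸ ENNReal.ofReal_ne_top, ⟨⟨h, hh, hfix⟩, ?_⟩, N, hN⟩
  rintro _ ⟨h', -, rfl⟩
  exact hd.le_g_of_fixed hp0 p.2.2 q.2.1 q.2.2 hfix h'
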